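/- Let $p\ge 1$ be fixed, $\mu\in\mathbb R^p$, and let $\Sigma$ be a symmetric positive definite $p\times p$ matrix. For a partition $B$ of $\{1,\dots,p\}$ and a matrix $\Gamma$, let $\Gamma_B$ be $\Gamma$ with the entries $\gamma_{ij}$ for which $i,j$ are in different groups of $B$ replaced by $0$, and let $B(\Gamma)$ be the finest partition $B$ with $\Gamma=\Gamma_B$. Write $S_p^{++}(\mathbb R,B)$ for the set of symmetric positive definite $\Gamma$ with $B(\Gamma)=B$, and suppose $\Sigma\in S_p^{++}(\mathbb R,B^*)$. Let $X^{(1)},X^{(2)},\dots$ be i.i.d. with law $\mathcal N(\mu,\Sigma)$ and $$\overline X=\frac1n\sum_{l=1}^nX^{(l)},\qquad S=S_n=\frac1n\sum_{l=1}^n(X^{(l)}-\overline X)(X^{(l)}-\overline X)^T .$$ Fix $\delta\in(0,1/2)$, put $\kappa=1/(pn^\delta)$, $\mathrm{pen}(B)=\sum_{A\in B}|A|^2$, and $$\Phi(\Gamma)=\frac1p\bigl(\log|\Gamma|+\mathrm{Tr}(\Gamma^{-1}S)\bigr)+\kappa\,\mathrm{pen}(B(\Gamma)),\qquad \Psi(B)=\Phi(S_B).$$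 Let $\widehat C_{ij}=s_{ij}/\sqrt{s_{ii}s_{jj}}$ be the empirical correlations, and for $\lambda\in[0,1]$ let $B_\lambda=B\bigl((\widehat C_{ij}\mathbf 1_{|\widehat C_{ij}|>\lambda})_{i,j}\bigr)$. Let $\widehat B$ be one of the following two estimators of $B^*$ (defined when $S$ is positive definite, in case of ties as any measurable choice of a minimiser; arbitrary otherwise): * $\widehat B_{tot}\in\arg\min\Psi$ over all partitions of $\{1,\dots,p\}$; * $\widehat B_{\widehat C}\in\arg\min\Psi$ over the partitions $B_\lambda$, $\lambda\in\{|\widehat C_{ij}|:1\le i<j\le p\}$; for this estimator suppose that $p\ge3$, or that $p=2$ and $\Sigma$ is diagonal. Let $J$ be the $p^2\times p^2$ Fisher information matrix of $\mathrm{vec}(\Gamma)$ at $\Gamma=\Sigma$ for one observation of $\mathcal N(0,\Gamma)$ with all $p^2$ entries of $\Gamma$ treated as free parameters, i.e. minus the expectation under $\mathcal N(0,\Sigma)$ of the Hessian of $\Gamma\mapsto\log\bigl[(2\pi)^{-p/2}|\Gamma|^{-1/2}\exp(-\tfrac12x^T\Gamma^{-1}x)\bigr]$ at $\Sigma$. Let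 $U$ be a matrix whose columns form an orthonormal basis of the linear subspace $\{\mathrm{vec}(\Gamma):\Gamma=\Gamma^T,\ \Gamma_{B^*}=\Gamma\}$ of $\mathbb R^{p^2}$, and let $$\mathrm{CR}(\Sigma,B^*)=U(U^TJU)^{-1}U^T$$ be the linearly constrained Cramér–Rao bound of $\mathrm{vec}(\Sigma)$ in the model $\{\mathcal N(0,\Gamma):\Gamma\in S_p^{++}(\mathbb R,B^*)\}$. Then $\mathrm{CR}(\Sigma,B^*)$ is positive semidefinite and $$\sqrt n\,\bigl(\mathrm{vec}(S_{\widehat B})-\mathrm{vec}(\Sigma)\bigr)\ \xrightarrow[n\to\infty]{\mathcal L}\ \mathcal N\bigl(0,\mathrm{CR}(\Sigma,B^*)\bigr),$$ that is, $S_{\widehat B}$ is asymptotically efficient, as if $B^*$ were known. -/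

import Mathlib

open MeasureTheory ProbabilityTheory Filter
open scoped Matrix

noncomputable section

namespace BlockCov

/-! ### Partitions and block structure

A partition of the index set is represented by its equivalence relation `B : Setoid (Fin p)`:
`B i j` says that `i` and `j` are in the same group, and `B ≤ B'` says that `B` is finer
than `B'`. -/

open Classical in
/-- `Γ_B`: the entries of `Γ` with `(i, j) ∈ B` are kept, the others are replaced by `0`. -/
def blockPart {p : ℕ} (B : Setoid (Fin p)) (Γ : Matrix (Fin p) (Fin p) ℝ) :
    Matrix (Fin p) (Fin p) ℝ :=
  Matrix.of fun i j => if B i j then Γ i j else 0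

/-- The finest partition `B(Γ)` such that `Γ = Γ_B`. -/
def finestPartition {p : ℕ} (Γ : Matrix (Fin p) (Fin p) ℝ) : Setoid (Fin p) :=
  sInf {B | blockPart B Γ = Γ}

/-- The infimum defining `finestPartition` is attained. -/
theorem blockPart_finestPartition {p : ℕ} (Γ : Matrix (Fin p) (Fin p) ℝ) :
    blockPart (finestPartition Γ) Γ = Γ := by
  ext i j
  by_cases h : finestPartition Γ i j
  · simp [blockPart, h]
  · have h' : ¬ ∀ B ∈ {B | blockPart B Γ = Γ}, (B : Setoid (Fin p)) i j := fun H =>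
      h (Setoid.sInf_iff.2 H)
    push Not at h'
    obtain ⟨B, hB, hij⟩ := h'
    have h0 : Γ i j = 0 := by
      have := congrFun (congrFun hB i) j
      simpa [blockPart, hij] using this.symm
    simp [blockPart, h0]

/-- `S_p^{++}(ℝ, B)`: the symmetric positive definite matrices whose finest block structure
is `B`. -/
def posDefWithStructure {p : ℕ} (B : Setoid (Fin p)) : Set (Matrix (Fin p) (Fin p) ℝ) :=
  {Γ | Γ.PosDef ∧ Γ = blockPart B Γ ∧ ∀ B' < B, Γ ≠ blockPart B' Γ}

/-! ### Empirical quantities of a sample `x 0, …, x (n - 1)` -/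

/-- The empirical mean. -/
def empMean {p : ℕ} (n : ℕ) (x : ℕ → EuclideanSpace ℝ (Fin p)) : EuclideanSpace ℝ (Fin p) :=
  (n : ℝ)⁻¹ • ∑ l ∈ Finset.range n, x l

/-- The empirical covariance matrix `S_n`. -/
def empCov {p : ℕ} (n : ℕ) (x : ℕ → EuclideanSpace ℝ (Fin p)) : Matrix (Fin p) (Fin p) ℝ :=
  (n : ℝ)⁻¹ • ∑ l ∈ Finset.range n,
    Matrix.vecMulVec (x l - empMean n x).ofLp (x l - empMean n x).ofLp

/-- The correlation matrix `s_ij / √(s_ii s_jj)` of a covariance matrix `S`. -/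
def correlation {p : ℕ} (S : Matrix (Fin p) (Fin p) ℝ) : Matrix (Fin p) (Fin p) ℝ :=
  Matrix.of fun i j => S i j / √(S i i * S j j)

/-! ### The penalised likelihood criterion and the two structure estimators -/

/-- The normalised Gaussian negative log-likelihood
`l_Γ = (log |Γ| + Tr (Γ⁻¹ S)) / p`, where `S` is the empirical covariance matrix. -/
def negLogLik {p : ℕ} (S Γ : Matrix (Fin p) (Fin p) ℝ) : ℝ :=
  (1 / (p : ℝ)) * (Real.log Γ.det + (Γ⁻¹ * S).trace)

/-- The penalty of a partition: the sum of the squared sizes of its groups. -/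
def pen {p : ℕ} (B : Setoid (Fin p)) : ℝ :=
  ∑ᶠ A ∈ B.classes, (A.ncard : ℝ) ^ 2

/-- The criterion `Φ(Γ) = l_Γ + κ pen(B(Γ))`. -/
def penCrit {p : ℕ} (κ : ℝ) (S Γ : Matrix (Fin p) (Fin p) ℝ) : ℝ :=
  negLogLik S Γ + κ * pen (finestPartition Γ)

/-- The criterion on partitions `Ψ(B) = Φ(S_B)`. -/
def partCrit {p : ℕ} (κ : ℝ) (S : Matrix (Fin p) (Fin p) ℝ) (B : Setoid (Fin p)) : ℝ :=
  penCrit κ S (blockPart B S)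

/-- The penalisation coefficient `κ = 1 / (p n ^ δ)`. -/
def kappa (p n : ℕ) (δ : ℝ) : ℝ := 1 / ((p : ℝ) * (n : ℝ) ^ δ)

/-- `a` is a minimiser of `f` over the set `s`. -/
def IsArgmin {α : Type*} (f : α → ℝ) (s : Set α) (a : α) : Prop := a ∈ s ∧ IsMinOn f s a

open Classical in
/-- `B_t`: the finest partition of the empirical correlation matrix in which only the
coefficients of absolute value `> t` are kept. -/
def thresholdPartition {p : ℕ} (S : Matrix (Fin p) (Fin p) ℝ) (t : ℝ) : Setoid (Fin p) :=
  finestPartition (Matrix.of fun i j =>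
    if t < |correlation S i j| then correlation S i j else 0)

/-- The grid of thresholds `{|Ĉ_ij| : i < j}`. -/
def thresholdGrid {p : ℕ} (S : Matrix (Fin p) (Fin p) ℝ) : Set ℝ :=
  {t | ∃ i j : Fin p, i < j ∧ t = |correlation S i j|}

/-- `B` is a value of the estimator `B̂_tot`: a minimiser of `Ψ` over all partitions. -/
def IsBtot {p : ℕ} (κ : ℝ) (S : Matrix (Fin p) (Fin p) ℝ) (B : Setoid (Fin p)) : Prop :=
  IsArgmin (partCrit κ S) Set.univ B

/-- `B` is a value of the estimator `B̂_Ĉ`: a minimiser of `Ψ` over the partitions `B_t` obtained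
by thresholding the empirical correlation matrix at the levels `t` of the grid. -/
def IsBcorr {p : ℕ} (κ : ℝ) (S : Matrix (Fin p) (Fin p) ℝ) (B : Setoid (Fin p)) : Prop :=
  IsArgmin (partCrit κ S) (thresholdPartition S '' thresholdGrid S) B

/-! ### The linearly constrained Cramér-Rao bound -/

/-- Column vectorisation of a square matrix, as a vector of Euclidean space. -/
def vecE {p : ℕ} (A : Matrix (Fin p) (Fin p) ℝ) : EuclideanSpace ℝ (Fin p × Fin p) :=
  WithLp.toLp 2 A.vec

/-- The inverse of column vectorisation. -/
def unvec {p : ℕ} (θ : Fin p × Fin p → ℝ) : Matrix (Fin p) (Fin p) ℝ :=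
  Matrix.of fun i j => θ (j, i)

theorem unvec_vec {p : ℕ} (A : Matrix (Fin p) (Fin p) ℝ) : unvec A.vec = A := rfl

/-- The Fisher information matrix at `θ` of a model with parameter in `ℝ^d`, log-density `ℓ θ`
and law `Q` of one observation (at the parameter `θ`):
`J_ab = - E [∂_a ∂_b ℓ θ]`. -/
def fisherInformation {d E : Type*} [DecidableEq d] [MeasurableSpace E]
    (ℓ : (d → ℝ) → E → ℝ) (Q : Measure E) (θ : d → ℝ) : Matrix d d ℝ :=
  Matrix.of fun a b =>
    -∫ x, deriv (fun s : ℝ => deriv (fun t : ℝ =>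
      ℓ (θ + s • Pi.single a 1 + t • Pi.single b 1) x) 0) 0 ∂Q

/-- The Cramér-Rao bound `U (Uᵀ J U)⁻¹ Uᵀ` for a parameter constrained to the linear subspace `V`,
where the columns of `U` form an orthonormal basis of `V` (it does not depend on the basis) and
`J` is the unconstrained Fisher information matrix. -/
def constrainedCRBound {d : Type*} [Fintype d] (J : Matrix d d ℝ)
    (V : Submodule ℝ (EuclideanSpace ℝ d)) : Matrix d d ℝ :=
  let U : Matrix d (Fin (Module.finrank ℝ V)) ℝ :=
    Matrix.of fun a k => (stdOrthonormalBasis ℝ V k : EuclideanSpace ℝ d) a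
  U * (Uᵀ * J * U)⁻¹ * Uᵀ

/-- The density of `N(0, Γ)` on `ℝ^p`. -/
def gaussianDensity {p : ℕ} (Γ : Matrix (Fin p) (Fin p) ℝ) (x : EuclideanSpace ℝ (Fin p)) : ℝ :=
  1 / √((2 * Real.pi) ^ p * Γ.det) * Real.exp (-(1 / 2) * (x.ofLp ⬝ᵥ Γ⁻¹ *ᵥ x.ofLp))

/-- The Fisher information matrix of `vec Γ` at `Γ = Sig`, for one observation with law `N(0, Γ)`,
all the `p²` entries of `Γ` being free parameters. -/
def gaussianFisher {p : ℕ} (Sig : Matrix (Fin p) (Fin p) ℝ) :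
    Matrix (Fin p × Fin p) (Fin p × Fin p) ℝ :=
  fisherInformation (fun θ x => Real.log (gaussianDensity (unvec θ) x))
    (multivariateGaussian 0 Sig) Sig.vec

/-- The linear subspace of the vectorisations of the symmetric matrices `Γ` with `Γ_B = Γ`. -/
def structureSpace {p : ℕ} (B : Setoid (Fin p)) :
    Submodule ℝ (EuclideanSpace ℝ (Fin p × Fin p)) where
  carrier := {v | ∃ Γ : Matrix (Fin p) (Fin p) ℝ, Γ.IsSymm ∧ blockPart B Γ = Γ ∧ v = vecE Γ}
  zero_mem' := ⟨0, Matrix.isSymm_zero, by ext i j; simp [blockPart], by ext i; simp [vecE]⟩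
  add_mem' := by
    rintro _ _ ⟨Γ, h1, h2, rfl⟩ ⟨Γ', h1', h2', rfl⟩
    refine ⟨Γ + Γ', h1.add h1', ?_, by ext i; simp [vecE]⟩
    conv_rhs => rw [← h2, ← h2']
    ext i j
    by_cases h : B i j <;> simp [blockPart, h]
  smul_mem' := by
    rintro c _ ⟨Γ, h1, h2, rfl⟩
    refine ⟨c • Γ, h1.smul c, ?_, by ext i; simp [vecE]⟩
    conv_rhs => rw [← h2]
    ext i j
    by_cases h : B i j <;> simp [blockPart, h]

/-- `CR(Sig, B)`: the Cramér-Rao bound of `vec Sig` in the model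
`{N(0, Γ) : Γ ∈ S_p^{++}(ℝ, B)}`, for one observation. -/
def CR {p : ℕ} (Sig : Matrix (Fin p) (Fin p) ℝ) (B : Setoid (Fin p)) :
    Matrix (Fin p × Fin p) (Fin p × Fin p) ℝ :=
  constrainedCRBound (gaussianFisher Sig) (structureSpace B)

end BlockCov

end

namespace BlockCov

/-! ### Block structure -/

section Block

variable {p : ℕ} {B B' : Setoid (Fin p)} {Γ T N S : Matrix (Fin p) (Fin p) ℝ}

/-! With probability tending to one the selected matrix `S_B̂` equals the oracle matrix `S_{B*}`, so
by Slutsky the claim reduces to a central limit theorem for the oracle.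

Oracle. A linear functional of `S_{B*}` in direction `t` is, up to the effect of the empirical mean,
an average of the quadratic forms `xᵀGx`, where `G` is the projection of `t` on the symmetric
matrices with structure `B*`. Under `N(0, Σ)` such a form has variance `2 tr(GΣGΣ)`. On symmetric
matrices the Fisher information is `W ↦ ½ Σ⁻¹WΣ⁻¹`. Its inverse `W ↦ 2ΣWΣ` preserves the structure
space, because `Σ` has structure `B*`; hence the constrained bound is this inverse compressed by the
orthogonal projection, and its quadratic form at `t` is the same `2 tr(GΣGΣ)` (`CR_mulVec`).
Characteristic functions then give the limit (`tendstoInDistribution_blockPart_empCov`).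

Selection. Since `Tr(S_B⁻¹ S) = p` for every `B`, `pΨ(B)` is `log|S_B| + p` plus `n^(-δ)` times a
penalty, while `S - Σ` is of order `n^(-1/2)`, negligible against `n^(-δ)`. If `Σ_B ≠ Σ`, the strict
Fischer inequality (`det_lt_det_blockPart`) leaves a fixed gap that a vanishing penalty cannot
offset. If `Σ_B = Σ`, the log-determinants agree up to `o(n^(-δ))`, and a structure strictly coarser
than `B*` pays at least `n^(-δ)` more (`blockPart_eq_of_isArgmin`).

Thresholding. `B*` must be among the candidates. If `Σ` has a zero off the diagonal, the largest
empirical correlation over the zeros is a suitable threshold. Otherwise `B*` is the one-group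
partition: the smallest threshold removes a single pair unless there are ties, and a third index
reconnects it. Ties are negligible by a delta-method argument (`tendsto_measure_tie`). -/

theorem blockPart_of_rel {i j : Fin p} (h : B i j) : blockPart B Γ i j = Γ i j := by
  simp [blockPart, h]

theorem blockPart_of_not_rel {i j : Fin p} (h : ¬ B i j) : blockPart B Γ i j = 0 := by
  simp [blockPart, h]

theorem blockPart_eq_self_iff : blockPart B Γ = Γ ↔ ∀ i j, Γ i j ≠ 0 → B i j := by
  constructor
  · intro h i j hij
    by_contra hB
    exact hij (by rw [← h, blockPart_of_not_rel hB])
  · intro h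
    ext i j
    by_cases hB : B i j
    · rw [blockPart_of_rel hB]
    · rw [blockPart_of_not_rel hB]
      by_contra h0
      exact hB (h i j (Ne.symm h0))

theorem blockPart_diag (i : Fin p) : blockPart B Γ i i = Γ i i :=
  blockPart_of_rel (B.refl' i)

theorem blockPart_idem : blockPart B (blockPart B Γ) = blockPart B Γ := by
  ext i j
  by_cases h : B i j
  · rw [blockPart_of_rel h]
  · rw [blockPart_of_not_rel h, blockPart_of_not_rel h]

theorem blockPart_blockPart_of_le (h : B' ≤ B) :
    blockPart B' (blockPart B Γ) = blockPart B' Γ := by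
  ext i j
  by_cases h' : B' i j
  · rw [blockPart_of_rel h', blockPart_of_rel h', blockPart_of_rel (h h')]
  · rw [blockPart_of_not_rel h', blockPart_of_not_rel h']

theorem blockPart_top : blockPart ⊤ Γ = Γ := by
  ext i j
  exact blockPart_of_rel trivial

theorem blockPart_transpose : (blockPart B Γ)ᵀ = blockPart B Γᵀ := by
  ext i j
  by_cases h : B i j
  · rw [blockPart_of_rel h, Matrix.transpose_apply, blockPart_of_rel (B.symm' h),
      Matrix.transpose_apply]
  · rw [blockPart_of_not_rel h, Matrix.transpose_apply,
      blockPart_of_not_rel fun h' => h (B.symm' h')]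

theorem blockPart_sub : blockPart B (Γ - T) = blockPart B Γ - blockPart B T := by
  ext i j
  by_cases h : B i j
  · simp only [Matrix.sub_apply, blockPart_of_rel h]
  · simp only [Matrix.sub_apply, blockPart_of_not_rel h, sub_zero]

theorem blockPart_smul (c : ℝ) : blockPart B (c • Γ) = c • blockPart B Γ := by
  ext i j
  by_cases h : B i j
  · simp only [Matrix.smul_apply, blockPart_of_rel h]
  · simp only [Matrix.smul_apply, blockPart_of_not_rel h, smul_zero]

/-- A nonzero `T i k` forces `k` into the group of `i`, so `B k j` and `B i j` are equivalent in
every term that matters. Closure of the block matrices under products and inverses follows. -/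
theorem mul_blockPart (hT : blockPart B T = T) : T * blockPart B N = blockPart B (T * N) := by
  rw [blockPart_eq_self_iff] at hT
  ext i j
  by_cases h : B i j
  · rw [blockPart_of_rel h, Matrix.mul_apply, Matrix.mul_apply]
    refine Finset.sum_congr rfl fun k _ => ?_
    by_cases hk : T i k = 0
    · simp [hk]
    · rw [blockPart_of_rel (B.trans' (B.symm' (hT i k hk)) h)]
  · rw [blockPart_of_not_rel h, Matrix.mul_apply]
    refine Finset.sum_eq_zero fun k _ => ?_
    by_cases hk : T i k = 0
    · simp [hk]
    · rw [blockPart_of_not_rel fun h' => h (B.trans' (hT i k hk) h'), mul_zero]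

theorem blockPart_mul_eq_self (hT : blockPart B T = T) (hN : blockPart B N = N) :
    blockPart B (T * N) = T * N := by
  rw [← mul_blockPart hT, hN]

theorem blockPart_one : blockPart B (1 : Matrix (Fin p) (Fin p) ℝ) = 1 := by
  rw [blockPart_eq_self_iff]
  intro i j h
  by_cases hij : i = j
  · exact hij ▸ B.refl' i
  · exact absurd (Matrix.one_apply_ne hij) h

theorem blockPart_inv_eq_self (hT : blockPart B T = T) (hdet : IsUnit T.det) :
    blockPart B T⁻¹ = T⁻¹ := by
  refine (Matrix.inv_eq_right_inv ?_).symm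
  rw [mul_blockPart hT, Matrix.mul_nonsing_inv _ hdet, blockPart_one]

/-- The trace reads only diagonal entries, which every block part keeps. -/
theorem trace_mul_blockPart (hN : blockPart B N = N) :
    (N * blockPart B S).trace = (N * S).trace := by
  rw [mul_blockPart hN]
  exact Finset.sum_congr rfl fun i _ => blockPart_diag i

theorem finestPartition_le_iff : finestPartition Γ ≤ B ↔ ∀ i j, Γ i j ≠ 0 → B i j := by
  constructor
  · intro h i j hij
    exact h (blockPart_eq_self_iff.1 (blockPart_finestPartition Γ) i j hij)
  · intro h
    exact sInf_le (blockPart_eq_self_iff.2 h)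

theorem rel_finestPartition {i j : Fin p} (h : Γ i j ≠ 0) : finestPartition Γ i j :=
  finestPartition_le_iff.1 le_rfl i j h

theorem finestPartition_mono (h : ∀ i j, i ≠ j → Γ i j ≠ 0 → T i j ≠ 0) :
    finestPartition Γ ≤ finestPartition T := by
  refine finestPartition_le_iff.2 fun i j hij => ?_
  by_cases e : i = j
  · exact e ▸ (finestPartition T).refl' i
  · exact rel_finestPartition (h i j e hij)

theorem finestPartition_eq_of_mem (h : Γ ∈ posDefWithStructure B) : finestPartition Γ = B := by
  obtain ⟨_, h1, h2⟩ := h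
  rcases (finestPartition_le_iff.2 (blockPart_eq_self_iff.1 h1.symm)).lt_or_eq with h | h
  · exact absurd (blockPart_finestPartition Γ).symm (h2 _ h)
  · exact h

/-- Counting related pairs makes the penalty integer valued and strictly monotone, hence a jump of
at least `1` between nested distinct partitions. -/
theorem pen_eq_ncard (B : Setoid (Fin p)) :
    pen B = ({q : Fin p × Fin p | B q.1 q.2}.ncard : ℝ) := by
  classical
  have hfin : (B.classes).Finite := Set.toFinite _
  have hU : {q : Fin p × Fin p | B q.1 q.2} = ⋃ A ∈ hfin.toFinset, A ×ˢ A := by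
    ext ⟨i, j⟩
    simp only [Set.mem_ofPred_eq, Set.mem_iUnion, Set.mem_prod, Set.Finite.mem_toFinset]
    rw [Setoid.rel_iff_exists_classes]
    simp only [exists_prop]
  rw [pen, finsum_mem_eq_finite_toFinset_sum _ hfin, hU]
  rw [Set.ncard_eq_toFinset_card']
  have : (⋃ A ∈ hfin.toFinset, A ×ˢ A).toFinset
      = hfin.toFinset.biUnion fun A => (A ×ˢ A).toFinset := by
    ext q
    simp only [Set.mem_toFinset, Set.mem_iUnion, Finset.mem_biUnion, exists_prop]
  rw [this, Finset.card_biUnion]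
  · push_cast
    refine Finset.sum_congr rfl fun A _ => ?_
    rw [← Set.ncard_eq_toFinset_card', Set.ncard_prod]
    push_cast; ring
  · intro A hA A' hA' hne
    refine Set.disjoint_toFinset.2 (Set.disjoint_left.2 ?_)
    rintro ⟨i, j⟩ h h'
    exact hne (Setoid.eq_of_mem_classes ((Set.Finite.mem_toFinset hfin).1 hA) h.1
      ((Set.Finite.mem_toFinset hfin).1 hA') h'.1)

theorem pen_nonneg (B : Setoid (Fin p)) : 0 ≤ pen B := by
  rw [pen_eq_ncard]; positivity

theorem pen_le (B : Setoid (Fin p)) : pen B ≤ (p : ℝ) ^ 2 := by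
  rw [pen_eq_ncard]
  have := Set.ncard_le_ncard (Set.subset_univ {q : Fin p × Fin p | B q.1 q.2})
  rw [Set.ncard_univ, Nat.card_eq_fintype_card, Fintype.card_prod, Fintype.card_fin] at this
  rw [sq]; exact_mod_cast this

theorem pen_add_one_le (h : B < B') : pen B + 1 ≤ pen B' := by
  rw [pen_eq_ncard, pen_eq_ncard]
  have : {q : Fin p × Fin p | B q.1 q.2} ⊂ {q : Fin p × Fin p | B' q.1 q.2} := by
    refine Set.ssubset_iff_subset_ne.2 ⟨fun q hq => h.le hq, fun he => h.ne ?_⟩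
    ext i j
    exact Set.ext_iff.1 he (i, j)
  exact_mod_cast Set.ncard_lt_ncard this

end Block

/-! ### Fischer's inequality -/

section Fischer

variable {p : ℕ} {B : Setoid (Fin p)} {S T : Matrix (Fin p) (Fin p) ℝ}

open Classical in
/-- The part of a vector carried by a group of a partition. -/
noncomputable def groupPart (B : Setoid (Fin p)) (c : Quotient B) (x : Fin p → ℝ) : Fin p → ℝ :=
  fun i => if (⟦i⟧ : Quotient B) = c then x i else 0

/-- Splitting the form over the groups makes `blockPart B S` inherit positivity from `S`. -/
theorem dotProduct_blockPart_mulVec (x : Fin p → ℝ) :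
    x ⬝ᵥ blockPart B S *ᵥ x = ∑ᶠ c : Quotient B, groupPart B c x ⬝ᵥ S *ᵥ groupPart B c x := by
  classical
  rw [finsum_eq_sum_of_fintype]
  simp only [dotProduct, Matrix.mulVec, Finset.mul_sum]
  conv_rhs => rw [Finset.sum_comm]
  refine Finset.sum_congr rfl fun i _ => ?_
  conv_rhs => rw [Finset.sum_comm]
  refine Finset.sum_congr rfl fun j _ => ?_
  simp only [groupPart, ite_mul, zero_mul, Finset.sum_ite_eq, Finset.mem_univ, if_true]
  by_cases h : B i j
  · rw [blockPart_of_rel h, if_pos (Quotient.sound (B.symm' h))]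
  · rw [blockPart_of_not_rel h, if_neg fun h' => h (B.symm' (Quotient.exact h'))]
    simp

theorem posDef_blockPart (hS : S.PosDef) : (blockPart B S).PosDef := by
  classical
  refine Matrix.PosDef.of_dotProduct_mulVec_pos ?_ fun x hx => ?_
  · have := hS.isHermitian
    rw [Matrix.IsHermitian, Matrix.conjTranspose_eq_transpose_of_trivial] at this ⊢
    rw [blockPart_transpose, this]
  · obtain ⟨i, hi⟩ := Function.ne_iff.1 hx
    rw [star_trivial, dotProduct_blockPart_mulVec, finsum_eq_sum_of_fintype]
    refine Finset.sum_pos' (fun c _ => ?_) ⟨⟦i⟧, Finset.mem_univ _, ?_⟩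
    · simpa using hS.posSemidef.dotProduct_mulVec_nonneg (groupPart B c x)
    · have : groupPart B ⟦i⟧ x ≠ 0 := fun h => hi (by simpa [groupPart] using congrFun h i)
      simpa using hS.dotProduct_mulVec_pos this

/-- A positive definite matrix of size `p` and trace `p` has determinant at most `1`, with equality
only for the identity. -/
theorem det_lt_one_of_trace_eq {M : Matrix (Fin p) (Fin p) ℝ} (hM : M.PosDef)
    (htr : M.trace = p) (hne : M ≠ 1) : M.det < 1 := by
  have hpos := hM.eigenvalues_pos
  have hsum : ∑ i, (hM.1.eigenvalues i - 1) = 0 := by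
    have := hM.1.trace_eq_sum_eigenvalues
    simp only [RCLike.ofReal_real_eq_id, id_eq] at this
    simp [Finset.sum_sub_distrib, ← this, htr]
  have hdet : M.det = ∏ i, hM.1.eigenvalues i := by
    simpa using hM.1.det_eq_prod_eigenvalues
  obtain ⟨k, hk⟩ : ∃ k, hM.1.eigenvalues k ≠ 1 := by
    by_contra! h
    refine hne ?_
    have h1 : (RCLike.ofReal ∘ hM.1.eigenvalues : Fin p → ℝ) = fun _ => 1 := by
      ext i; simp [h i]
    rw [hM.1.spectral_theorem, h1, Matrix.diagonal_one, map_one]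
  have hlog : Real.log M.det < 0 := by
    rw [hdet, Real.log_prod fun i _ => (hpos i).ne']
    refine lt_of_lt_of_eq ?_ hsum
    exact Finset.sum_lt_sum (fun i _ => Real.log_le_sub_one_of_pos (hpos i))
      ⟨k, Finset.mem_univ _, Real.log_lt_sub_one_of_pos (hpos k) hk⟩
  exact (Real.log_neg_iff hM.det_pos).1 hlog

/-- The inverse of `S_B` has structure `B`, so the trace does not see the entries of `S` outside the
blocks. The trace term of the likelihood is therefore the same for all partitions. -/
theorem trace_inv_blockPart_mul (hS : S.PosDef) : ((blockPart B S)⁻¹ * S).trace = p := by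
  have hdet : IsUnit (blockPart B S).det := (posDef_blockPart hS).det_pos.ne'.isUnit
  rw [← trace_mul_blockPart (blockPart_inv_eq_self blockPart_idem hdet),
    Matrix.nonsing_inv_mul _ hdet, Matrix.trace_one, Fintype.card_fin]

open scoped MatrixOrder in
-- Strict Fischer inequality. With `S_B⁻¹ = RᴴR`, the matrix `R S Rᴴ` has trace `p` and determinant
-- `|S| / |S_B|`, and it is the identity only if `S_B = S`; the arithmetic-geometric inequality for
-- its eigenvalues concludes.
theorem det_lt_det_blockPart (hS : S.PosDef) (hne : blockPart B S ≠ S) :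
    S.det < (blockPart B S).det := by
  have hT := posDef_blockPart (B := B) hS
  obtain ⟨R, hR⟩ := CStarAlgebra.nonneg_iff_eq_star_mul_self.mp hT.inv.posSemidef.nonneg
  rw [Matrix.star_eq_conjTranspose] at hR
  have hRdet : R.det ≠ 0 := by
    intro h
    have := hT.inv.det_pos
    rw [hR, Matrix.det_mul, h, mul_zero] at this
    exact this.false
  have hRu : IsUnit R := (Matrix.isUnit_iff_isUnit_det R).2 hRdet.isUnit
  have hM : (R * S * Rᴴ).PosDef :=
    hS.mul_mul_conjTranspose_same (Matrix.vecMul_injective_of_isUnit hRu)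
  have htr : (R * S * Rᴴ).trace = p := by
    rw [Matrix.trace_mul_comm, ← mul_assoc, ← hR, trace_inv_blockPart_mul hS]
  have hne1 : R * S * Rᴴ ≠ 1 := by
    intro h
    apply hne
    have h1 : S * (Rᴴ * R) = 1 := by
      have : (S * Rᴴ) * R = 1 := mul_eq_one_comm.1 (by rw [← mul_assoc, h])
      rw [← mul_assoc, this]
    rw [← hR] at h1
    calc blockPart B S = (S * (blockPart B S)⁻¹) * blockPart B S := by rw [h1, one_mul]
      _ = S := by
        rw [mul_assoc, Matrix.nonsing_inv_mul _ hT.det_pos.ne'.isUnit, mul_one]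
  have hlt := det_lt_one_of_trace_eq hM htr hne1
  have hinv : (Rᴴ * R).det = (blockPart B S).det⁻¹ := by
    rw [← hR, Matrix.det_nonsing_inv, Ring.inverse_eq_inv']
  have : (R * S * Rᴴ).det = S.det / (blockPart B S).det := by
    rw [div_eq_mul_inv, ← hinv, Matrix.det_mul, Matrix.det_mul, Matrix.det_mul]; ring
  rwa [this, div_lt_one hT.det_pos] at hlt

end Fischer

end BlockCov

namespace BlockCov

/-! ### Selection of the structure: the deterministic part -/

section Selection

variable {p : ℕ} {B B0 Bstar : Setoid (Fin p)} {S Sig : Matrix (Fin p) (Fin p) ℝ} {κ r : ℝ}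

theorem mul_partCrit (hp : 0 < p) (hS : S.PosDef) (hκ : p * κ = r) (B : Setoid (Fin p)) :
    p * partCrit κ S B =
      Real.log (blockPart B S).det + p + r * pen (finestPartition (blockPart B S)) := by
  have hp' : (p : ℝ) ≠ 0 := by positivity
  rw [partCrit, penCrit, negLogLik, trace_inv_blockPart_mul hS, ← hκ]
  field_simp

/-- Here `r` stands for `n^(-δ)`. The criterion depends on `B` only through `S_B`, so only `S_B` can
be identified. Two log-determinant errors of `r / 4` cost `r / 2`, less than one unit `r` of
penalty; in `hgap`, `p ^ 2` bounds the penalty of `Bstar` and the extra `1` absorbs the errors. -/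
theorem blockPart_eq_of_isArgmin (hp : 0 < p) (hSig : Sig ∈ posDefWithStructure Bstar)
    (hS : S.PosDef) (hr : 0 < r) (hκ : p * κ = r)
    (hlog : ∀ B, |Real.log (blockPart B S).det - Real.log (blockPart B Sig).det| ≤ r / 4)
    (hpat : ∀ i j, Sig i j ≠ 0 → S i j ≠ 0)
    (hgap : ∀ B, blockPart B Sig ≠ Sig →
      Real.log Sig.det + r * ((p : ℝ) ^ 2 + 1) < Real.log (blockPart B Sig).det)
    {𝓑 : Set (Setoid (Fin p))} (hB0 : B0 ∈ 𝓑) (hB0S : blockPart B0 S = blockPart Bstar S)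
    (hB : IsArgmin (partCrit κ S) 𝓑 B) : blockPart B S = blockPart Bstar S := by
  have hle : p * partCrit κ S B ≤ p * partCrit κ S Bstar := by
    have h1 : partCrit κ S B0 = partCrit κ S Bstar := by rw [partCrit, partCrit, hB0S]
    rw [← h1]
    exact mul_le_mul_of_nonneg_left (hB.2 hB0) (by positivity)
  rw [mul_partCrit hp hS hκ, mul_partCrit hp hS hκ] at hle
  have hstar := abs_le.1 (hlog Bstar)
  have hBl := abs_le.1 (hlog B)
  rw [← hSig.2.1] at hstar
  have hpenstar : pen (finestPartition (blockPart Bstar S)) ≤ pen Bstar := by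
    have : finestPartition (blockPart Bstar S) ≤ Bstar :=
      finestPartition_le_iff.2 (blockPart_eq_self_iff.1 blockPart_idem)
    rcases this.eq_or_lt with h | h
    · rw [h]
    · linarith [pen_add_one_le h]
  -- Either `B` loses nothing of `Sig` and a needlessly coarse structure is excluded by the penalty,
  -- or `B` cuts a nonzero entry and the likelihood gap excludes it.
  by_cases hBS : blockPart B Sig = Sig
  · rw [hBS] at hBl
    have hBB : Bstar ≤ B := by
      rw [← finestPartition_eq_of_mem hSig]
      exact finestPartition_le_iff.2 (blockPart_eq_self_iff.1 hBS)
    have hBB' : Bstar ≤ finestPartition (blockPart B S) := by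
      conv_lhs => rw [← finestPartition_eq_of_mem hSig]
      refine finestPartition_mono fun i j _ hij => ?_
      rw [blockPart_of_rel (blockPart_eq_self_iff.1 hBS i j hij)]
      exact hpat i j hij
    rcases hBB'.eq_or_lt with h | h
    · rw [← blockPart_finestPartition (blockPart B S), ← h, blockPart_blockPart_of_le hBB]
    · exfalso
      have h1 := mul_le_mul_of_nonneg_left (pen_add_one_le h) hr.le
      have h2 := mul_le_mul_of_nonneg_left hpenstar hr.le
      linarith
  · exfalso
    have h1 := mul_nonneg hr.le (pen_nonneg (finestPartition (blockPart B S)))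
    have h2 := mul_le_mul_of_nonneg_left (hpenstar.trans (pen_le Bstar)) hr.le
    linarith [hgap B hBS]

theorem correlation_symm (hS : S.IsSymm) (i j : Fin p) :
    correlation S i j = correlation S j i := by
  simp only [correlation, Matrix.of_apply, hS.apply i j, mul_comm (S i i)]

/-- Threshold at the largest correlation over the zeros of `Sig`. As the thresholding is strict, all
the zeros are removed, and `hcorr` keeps all other entries: the off-diagonal pattern of `Sig`
survives exactly. -/
theorem mem_thresholdPartition_of_zero (hSig : Sig ∈ posDefWithStructure Bstar)
    (hS : S.IsSymm) {k l : Fin p} (hkl : k < l) (h0 : Sig k l = 0)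
    (hcorr : ∀ i j k l, i ≠ j → k ≠ l → Sig i j ≠ 0 → Sig k l = 0 →
      |correlation S k l| < |correlation S i j|) :
    Bstar ∈ thresholdPartition S '' thresholdGrid S := by
  classical
  have hsym : ∀ i j, Sig i j = Sig j i := fun i j => hSig.1.isHermitian.apply j i
  obtain ⟨⟨a, b⟩, hab, hmax⟩ :=
    (Finset.univ.filter fun q : Fin p × Fin p => q.1 < q.2 ∧ Sig q.1 q.2 = 0).exists_max_image
      (fun q => |correlation S q.1 q.2|) ⟨(k, l), by simp [hkl, h0]⟩
  simp only [Finset.mem_filter, Finset.mem_univ, true_and] at hab hmax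
  refine ⟨|correlation S a b|, ⟨a, b, hab.1, rfl⟩, ?_⟩
  rw [← finestPartition_eq_of_mem hSig]
  refine le_antisymm (finestPartition_mono fun i j hij hne => ?_)
    (finestPartition_mono fun i j hij hne => ?_)
  · simp only [Matrix.of_apply, ne_eq, ite_eq_right_iff, Classical.not_imp] at hne
    intro hz
    rcases hij.lt_or_gt with h | h
    · exact (hmax (i, j) ⟨h, hz⟩).not_gt hne.1
    · have := hmax (j, i) ⟨h, by rw [hsym, hz]⟩
      rw [correlation_symm hS] at this
      exact this.not_gt hne.1
  · have h := hcorr i j a b hij hab.1.ne hne hab.2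
    simp only [Matrix.of_apply, if_pos h]
    exact abs_pos.1 ((abs_nonneg _).trans_lt h)

/-- Even the smallest threshold of the grid removes the pair attaining it. Without ties it removes
only that pair `(a, b)`, and any third index `c` links `a` to `b`. -/
theorem mem_thresholdPartition_of_ne_zero (hp : 3 ≤ p) (hSig : Sig ∈ posDefWithStructure Bstar)
    (hne : ∀ i j, i < j → Sig i j ≠ 0)
    (htie : ∀ i j k l, i < j → k < l → (i, j) ≠ (k, l) →
      |correlation S i j| ≠ |correlation S k l|) :
    Bstar ∈ thresholdPartition S '' thresholdGrid S := by
  classical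
  have hsym : ∀ i j, Sig i j = Sig j i := fun i j => hSig.1.isHermitian.apply j i
  have htop : Bstar = ⊤ := by
    rw [← finestPartition_eq_of_mem hSig, eq_top_iff]
    intro i j _
    rcases lt_trichotomy i j with h | h | h
    · exact rel_finestPartition (hne i j h)
    · exact h ▸ (finestPartition Sig).refl' i
    · exact rel_finestPartition (by rw [hsym]; exact hne j i h)
  obtain ⟨⟨a, b⟩, hab, hmin⟩ :=
    (Finset.univ.filter fun q : Fin p × Fin p => q.1 < q.2).exists_min_image
      (fun q => |correlation S q.1 q.2|)
      ⟨(⟨0, by omega⟩, ⟨1, by omega⟩), by simp⟩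
  simp only [Finset.mem_filter, Finset.mem_univ, true_and] at hab hmin
  refine ⟨|correlation S a b|, ⟨a, b, hab, rfl⟩, ?_⟩
  rw [htop, eq_top_iff]
  set R := thresholdPartition S |correlation S a b| with hR
  have hlt : ∀ i j, i < j → (i, j) ≠ (a, b) → R i j := by
    intro i j hij hq
    have h : |correlation S a b| < |correlation S i j| :=
      lt_of_le_of_ne (hmin (i, j) hij) (htie a b i j hab hij (Ne.symm hq))
    refine rel_finestPartition ?_
    simp only [Matrix.of_apply, if_pos h]
    exact abs_pos.1 ((abs_nonneg _).trans_lt h)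
  have hne' : ∀ i j, i ≠ j → (i, j) ≠ (a, b) → (j, i) ≠ (a, b) → R i j := by
    intro i j hij h1 h2
    rcases hij.lt_or_gt with h | h
    · exact hlt i j h h1
    · exact R.symm' (hlt j i h h2)
  obtain ⟨c, hca, hcb⟩ : ∃ c : Fin p, c ≠ a ∧ c ≠ b := by
    have : ({a, b} : Finset (Fin p)).card < (Finset.univ : Finset (Fin p)).card := by
      rw [Finset.card_univ, Fintype.card_fin]
      exact lt_of_le_of_lt Finset.card_le_two (by omega)
    obtain ⟨c, _, hc⟩ := Finset.exists_mem_notMem_of_card_lt_card this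
    simp only [Finset.mem_insert, Finset.mem_singleton, not_or] at hc
    exact ⟨c, hc⟩
  have hRab : R a b := R.trans' (hne' a c hca.symm (by simp [hcb]) (by simp [hca]))
    (hne' c b hcb (by simp [hca]) (by simp [hab.ne']))
  intro i j _
  by_cases hij : i = j
  · exact hij ▸ R.refl' i
  by_cases h1 : (i, j) = (a, b)
  · obtain ⟨rfl, rfl⟩ := Prod.mk.inj h1; exact hRab
  by_cases h2 : (j, i) = (a, b)
  · obtain ⟨rfl, rfl⟩ := Prod.mk.inj h2; exact R.symm' hRab
  exact hne' i j hij h1 h2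

end Selection

/-! ### Local estimates around the true covariance matrix -/

section Local

open Topology

variable {p : ℕ} {Sig S : Matrix (Fin p) (Fin p) ℝ}

theorem unvec_vecE (A : Matrix (Fin p) (Fin p) ℝ) : unvec (vecE A).ofLp = A := rfl

theorem vecE_unvec (v : EuclideanSpace ℝ (Fin p × Fin p)) : vecE (unvec v.ofLp) = v := rfl

theorem differentiable_det_blockPart (B : Setoid (Fin p)) :
    Differentiable ℝ fun v : EuclideanSpace ℝ (Fin p × Fin p) =>
      (blockPart B (unvec v.ofLp)).det := by
  have h : ∀ i j, Differentiable ℝ fun v : EuclideanSpace ℝ (Fin p × Fin p) =>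
      blockPart B (unvec v.ofLp) i j := by
    intro i j
    by_cases hB : B i j
    · simp only [blockPart_of_rel hB, unvec, Matrix.of_apply]
      fun_prop
    · simp only [blockPart_of_not_rel hB]
      fun_prop
  simp only [Matrix.det_apply]
  fun_prop

instance finite_setoid : Finite (Setoid (Fin p)) :=
  Finite.of_injective (fun B : Setoid (Fin p) => fun i j => B i j) fun _ _ h =>
    Setoid.ext fun i j => iff_of_eq (congrFun (congrFun h i) j)

/-- Differentiability at `Sig` gives a linear bound for each partition; summing the finitely many
constants makes it uniform. -/
theorem exists_eventually_abs_log_det_sub_le (hSig : Sig.PosDef) :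
    ∃ K > 0, ∀ᶠ v in 𝓝 (vecE Sig), ∀ B : Setoid (Fin p),
      |Real.log (blockPart B (unvec v.ofLp)).det - Real.log (blockPart B Sig).det|
        ≤ K * ‖v - vecE Sig‖ := by
  have h : ∀ B : Setoid (Fin p), ∃ K > 0, ∀ᶠ v in 𝓝 (vecE Sig),
      |Real.log (blockPart B (unvec v.ofLp)).det - Real.log (blockPart B Sig).det|
        ≤ K * ‖v - vecE Sig‖ := by
    intro B
    have hd : DifferentiableAt ℝ (fun v : EuclideanSpace ℝ (Fin p × Fin p) =>
        Real.log (blockPart B (unvec v.ofLp)).det) (vecE Sig) :=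
      (differentiable_det_blockPart B _).log (posDef_blockPart hSig).det_pos.ne'
    obtain ⟨K, hK, h⟩ := hd.isBigO_sub.exists_pos
    exact ⟨K, hK, h.bound⟩
  choose K hK h using h
  have : Fintype (Setoid (Fin p)) := Fintype.ofFinite _
  refine ⟨∑ B, K B, Finset.sum_pos (fun B _ => hK B) ⟨⊥, Finset.mem_univ _⟩, ?_⟩
  filter_upwards [eventually_all.2 h] with v hv B
  refine (hv B).trans (mul_le_mul_of_nonneg_right ?_ (norm_nonneg _))
  exact Finset.single_le_sum (fun B _ => (hK B).le) (Finset.mem_univ B)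

theorem continuous_unvec_apply (i j : Fin p) :
    Continuous fun v : EuclideanSpace ℝ (Fin p × Fin p) => unvec v.ofLp i j := by
  simp only [unvec, Matrix.of_apply]
  fun_prop

theorem eventually_det_ne_zero (hSig : Sig.PosDef) :
    ∀ᶠ v in 𝓝 (vecE Sig), (unvec v.ofLp : Matrix (Fin p) (Fin p) ℝ).det ≠ 0 := by
  have h := (differentiable_det_blockPart (⊤ : Setoid (Fin p))).continuous.continuousAt
    (x := vecE Sig)
  simp only [blockPart_top] at h
  exact h.eventually_ne hSig.det_pos.ne'

theorem eventually_pattern :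
    ∀ᶠ v in 𝓝 (vecE Sig), ∀ i j, Sig i j ≠ 0 → unvec v.ofLp i j ≠ 0 := by
  refine eventually_all.2 fun i => eventually_all.2 fun j => eventually_imp_distrib_left.2 fun h => ?_
  exact (continuous_unvec_apply i j).continuousAt.eventually_ne h

theorem continuousAt_correlation (hSig : Sig.PosDef) (i j : Fin p) :
    ContinuousAt (fun v : EuclideanSpace ℝ (Fin p × Fin p) => correlation (unvec v.ofLp) i j)
      (vecE Sig) := by
  simp only [correlation, Matrix.of_apply]
  have hc := fun i j => (continuous_unvec_apply (p := p) i j).continuousAt (x := vecE Sig)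
  refine (hc i j).div ((hc i i).mul (hc j j)).sqrt ?_
  rw [unvec_vecE]
  exact (Real.sqrt_pos.2 (mul_pos hSig.diag_pos hSig.diag_pos)).ne'

theorem eventually_correlation_lt (hSig : Sig.PosDef) :
    ∀ᶠ v in 𝓝 (vecE Sig), ∀ i j k l, i ≠ j → k ≠ l → Sig i j ≠ 0 → Sig k l = 0 →
      |correlation (unvec v.ofLp) k l| < |correlation (unvec v.ofLp) i j| := by
  refine eventually_all.2 fun i => eventually_all.2 fun j => eventually_all.2 fun k =>
    eventually_all.2 fun l => ?_
  by_cases h : Sig i j ≠ 0 ∧ Sig k l = 0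
  · refine (((continuousAt_correlation hSig k l).abs).eventually_lt
      ((continuousAt_correlation hSig i j).abs) ?_).mono fun v hv _ _ _ _ => hv
    rw [unvec_vecE]
    simp only [correlation, Matrix.of_apply, h.2, zero_div, abs_zero]
    exact abs_pos.2 (div_ne_zero h.1
      (Real.sqrt_pos.2 (mul_pos hSig.diag_pos hSig.diag_pos)).ne')
  · exact Eventually.of_forall fun v _ _ h1 h2 => absurd ⟨h1, h2⟩ h

end Local

end BlockCov

namespace BlockCov

/-! ### Moments of Gaussian quadratic forms -/

section Moments

/-- The moment is the fourth derivative at `0` of the moment generating function `exp (t ^ 2 / 2)`.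
-/
theorem integral_pow_four_gaussianReal : ∫ x, x ^ 4 ∂gaussianReal 0 1 = 3 := by
  have h := iteratedDeriv_mgf_zero (X := id) (μ := gaussianReal 0 1)
    (by simp [integrableExpSet_id_gaussianReal]) 4
  have he : ∀ x : ℝ, HasDerivAt (fun t : ℝ => Real.exp (t ^ 2 / 2)) (x * Real.exp (x ^ 2 / 2)) x := by
    intro x
    convert! (((hasDerivAt_id x).pow 2).div_const 2).exp using 1
    simp; ring
  have hd1 : deriv (fun t : ℝ => Real.exp (t ^ 2 / 2)) = fun x => x * Real.exp (x ^ 2 / 2) :=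
    funext fun x => (he x).deriv
  have hd2 : deriv (fun x : ℝ => x * Real.exp (x ^ 2 / 2))
      = fun x => (1 + x ^ 2) * Real.exp (x ^ 2 / 2) := by
    funext x
    rw [((hasDerivAt_id' x).fun_mul (he x)).deriv]
    ring
  have hd3 : deriv (fun x : ℝ => (1 + x ^ 2) * Real.exp (x ^ 2 / 2))
      = fun x => (3 * x + x ^ 3) * Real.exp (x ^ 2 / 2) := by
    funext x
    rw [((((hasDerivAt_id' x).fun_pow 2).const_add 1).fun_mul (he x)).deriv]
    simp; ring
  have hd4 : deriv (fun x : ℝ => (3 * x + x ^ 3) * Real.exp (x ^ 2 / 2)) 0 = 3 := by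
    rw [((((hasDerivAt_id' (0 : ℝ)).const_mul 3).fun_add ((hasDerivAt_id' (0 : ℝ)).fun_pow 3)).fun_mul
      (he 0)).deriv]
    simp
  have hm : mgf id (gaussianReal 0 1) = fun t : ℝ => Real.exp (t ^ 2 / 2) := by
    rw [mgf_id_gaussianReal]; simp
  rw [hm, iteratedDeriv_succ, iteratedDeriv_succ, iteratedDeriv_succ, iteratedDeriv_one, hd1, hd2,
    hd3, hd4] at h
  simpa using h.symm

theorem memLp_sq_gaussianReal : MemLp (fun x : ℝ => x ^ 2) 2 (gaussianReal 0 1) := by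
  have h := (memLp_id_gaussianReal' (μ := 0) (v := 1) 4 (by simp)).norm_rpow_div 2
  have e : (4 : ENNReal) / 2 = 2 := by
    rw [show (4 : ENNReal) = 2 * 2 by norm_num]
    exact ENNReal.mul_div_cancel_right (by simp) (by simp)
  rw [e] at h
  simpa using h

theorem integral_sq_gaussianReal : ∫ x, x ^ 2 ∂gaussianReal 0 1 = 1 := by
  have h := variance_id_gaussianReal (μ := 0) (v := 1)
  rw [variance_eq_integral (by fun_prop)] at h
  simpa using h

theorem variance_sq_gaussianReal : Var[fun x : ℝ => x ^ 2; gaussianReal 0 1] = 2 := by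
  rw [variance_eq_sub memLp_sq_gaussianReal]
  simp only [Pi.pow_apply, ← pow_mul]
  rw [integral_pow_four_gaussianReal, integral_sq_gaussianReal]
  norm_num

variable {p : ℕ} {G H Sig : Matrix (Fin p) (Fin p) ℝ}

/-- The quadratic form of a matrix. -/
def quadForm (H : Matrix (Fin p) (Fin p) ℝ) (x : EuclideanSpace ℝ (Fin p)) : ℝ :=
  x.ofLp ⬝ᵥ H *ᵥ x.ofLp

@[fun_prop]
theorem continuous_quadForm : Continuous (quadForm H) := by
  unfold quadForm
  simp only [dotProduct, Matrix.mulVec]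
  fun_prop

/-- In an eigenbasis the standard Gaussian still has independent coordinates, and the form becomes a
weighted sum of their squares, whose moments are explicit. -/
theorem quadForm_sum_eigenvectorBasis (hH : H.IsHermitian) (x : Fin p → ℝ) :
    quadForm H (∑ i, x i • hH.eigenvectorBasis i) = ∑ i, hH.eigenvalues i * x i ^ 2 := by
  have h1 : H *ᵥ (∑ i, x i • hH.eigenvectorBasis i).ofLp
      = (∑ i, (x i * hH.eigenvalues i) • hH.eigenvectorBasis i).ofLp := by
    simp only [WithLp.ofLp_sum, WithLp.ofLp_smul, Matrix.mulVec_sum, Matrix.mulVec_smul,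
      hH.mulVec_eigenvectorBasis, smul_smul]
  have h2 := hH.eigenvectorBasis.orthonormal.inner_sum x (fun i => x i * hH.eigenvalues i)
    Finset.univ
  rw [EuclideanSpace.inner_eq_star_dotProduct, star_trivial, dotProduct_comm] at h2
  rw [quadForm, h1, h2]
  refine Finset.sum_congr rfl fun i _ => ?_
  simp; ring

theorem trace_mul_self_eq_sum_eigenvalues_sq (hH : H.IsHermitian) :
    (H * H).trace = ∑ i, hH.eigenvalues i ^ 2 := by
  have h : H * H = Unitary.conjStarAlgAut ℝ _ hH.eigenvectorUnitary
      (Matrix.diagonal fun i => hH.eigenvalues i ^ 2) := by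
    conv_lhs => rw [hH.spectral_theorem]
    rw [← map_mul, Matrix.diagonal_mul_diagonal]
    congr 2
    ext i
    simp [sq]
  rw [h, Unitary.conjStarAlgAut_apply, Matrix.trace_mul_comm, ← mul_assoc,
    Unitary.coe_star_mul_self, one_mul, Matrix.trace_diagonal]

theorem memLp_quadForm_pi (c : Fin p → ℝ) :
    ∀ i, MemLp (fun x : ℝ => c i * x ^ 2) 2 (gaussianReal 0 1) :=
  fun i => memLp_sq_gaussianReal.const_mul (c i)

theorem memLp_quadForm_stdGaussian (hH : H.IsHermitian) :
    MemLp (quadForm H) 2 (stdGaussian (EuclideanSpace ℝ (Fin p))) := by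
  rw [stdGaussian_eq_map_pi_orthonormalBasis hH.eigenvectorBasis,
    memLp_map_measure_iff (by fun_prop)
      (Measurable.aemeasurable (by fun_prop))]
  simp only [Function.comp_def, quadForm_sum_eigenvectorBasis hH]
  refine memLp_finsetSum _ fun i _ => ?_
  exact (memLp_quadForm_pi hH.eigenvalues i).comp_measurePreserving
    (measurePreserving_eval (fun _ : Fin p => gaussianReal 0 1) i)

theorem integral_quadForm_stdGaussian (hH : H.IsHermitian) :
    ∫ x, quadForm H x ∂stdGaussian (EuclideanSpace ℝ (Fin p)) = H.trace := by
  rw [stdGaussian_eq_map_pi_orthonormalBasis hH.eigenvectorBasis,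
    integral_map (Measurable.aemeasurable (by fun_prop)) (by fun_prop)]
  simp only [quadForm_sum_eigenvectorBasis hH]
  rw [integral_finsetSum]
  · rw [hH.trace_eq_sum_eigenvalues]
    refine Finset.sum_congr rfl fun i _ => ?_
    rw [integral_const_mul]
    have h : ∫ a : Fin p → ℝ, a i ^ 2 ∂Measure.pi (fun _ => gaussianReal 0 1)
        = ∫ x, x ^ 2 ∂gaussianReal 0 1 :=
      integral_comp_eval (X := fun _ : Fin p => ℝ) (μ := fun _ => gaussianReal 0 1)
        (f := fun x : ℝ => x ^ 2) (by fun_prop)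
    rw [h, integral_sq_gaussianReal, mul_one]
    rfl
  · intro i _
    exact (measurePreserving_eval (fun _ : Fin p => gaussianReal 0 1) i).integrable_comp_of_integrable
      ((memLp_quadForm_pi hH.eigenvalues i).integrable (by norm_num))

theorem variance_quadForm_stdGaussian (hH : H.IsHermitian) :
    Var[quadForm H; stdGaussian (EuclideanSpace ℝ (Fin p))] = 2 * (H * H).trace := by
  rw [stdGaussian_eq_map_pi_orthonormalBasis hH.eigenvectorBasis,
    variance_map (by fun_prop) (Measurable.aemeasurable (by fun_prop))]
  have h : quadForm H ∘ (fun x : Fin p → ℝ => ∑ i, x i • hH.eigenvectorBasis i)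
      = ∑ i, fun x : Fin p → ℝ => hH.eigenvalues i * x i ^ 2 := by
    ext x
    simp [quadForm_sum_eigenvectorBasis hH]
  rw [h, variance_sum_pi (X := fun i (x : ℝ) => hH.eigenvalues i * x ^ 2)
    (memLp_quadForm_pi hH.eigenvalues), trace_mul_self_eq_sum_eigenvalues_sq hH, Finset.mul_sum]
  refine Finset.sum_congr rfl fun i _ => ?_
  rw [variance_const_mul, variance_sq_gaussianReal, mul_comm]

open scoped MatrixOrder in
-- Transfers moments from the standard Gaussian: the form of `G` at `A x` is the form of `A G A` at
-- `x`.
theorem exists_symm_sqrt (hSig : Sig.PosSemidef) :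
    ∃ A : Matrix (Fin p) (Fin p) ℝ, A.IsSymm ∧ A * A = Sig ∧
      multivariateGaussian 0 Sig = (stdGaussian (EuclideanSpace ℝ (Fin p))).map
        (fun x => WithLp.toLp 2 (A *ᵥ x.ofLp)) := by
  refine ⟨CFC.sqrt Sig, ?_, CFC.sqrt_mul_sqrt_self _ hSig.nonneg, ?_⟩
  · have := (Matrix.nonneg_iff_posSemidef.1 (CFC.sqrt_nonneg Sig)).isHermitian
    rwa [Matrix.IsHermitian, Matrix.conjTranspose_eq_transpose_of_trivial] at this
  · rw [multivariateGaussian]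
    congr 1
    ext x
    simp

theorem quadForm_toLp_mulVec {A : Matrix (Fin p) (Fin p) ℝ} (hA : A.IsSymm)
    (x : EuclideanSpace ℝ (Fin p)) :
    quadForm G (WithLp.toLp 2 (A *ᵥ x.ofLp)) = quadForm (A * G * A) x := by
  simp only [quadForm]
  rw [← Matrix.mulVec_mulVec, ← Matrix.mulVec_mulVec, Matrix.dotProduct_mulVec x.ofLp A,
    ← Matrix.mulVec_transpose, hA.eq]

theorem isHermitian_conj {A : Matrix (Fin p) (Fin p) ℝ} (hA : A.IsSymm) (hG : G.IsSymm) :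
    (A * G * A).IsHermitian := by
  rw [Matrix.IsHermitian, Matrix.conjTranspose_eq_transpose_of_trivial, Matrix.transpose_mul,
    Matrix.transpose_mul, hA.eq, hG.eq, mul_assoc]

theorem memLp_quadForm_multivariateGaussian (hSig : Sig.PosSemidef) (hG : G.IsSymm) :
    MemLp (quadForm G) 2 (multivariateGaussian 0 Sig) := by
  obtain ⟨A, hA, hAA, h⟩ := exists_symm_sqrt hSig
  rw [h, memLp_map_measure_iff (by fun_prop) (by fun_prop)]
  simp only [Function.comp_def, quadForm_toLp_mulVec hA]
  exact memLp_quadForm_stdGaussian (isHermitian_conj hA hG)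

theorem integral_quadForm_multivariateGaussian (hSig : Sig.PosSemidef) (hG : G.IsSymm) :
    ∫ x, quadForm G x ∂multivariateGaussian 0 Sig = (G * Sig).trace := by
  obtain ⟨A, hA, hAA, h⟩ := exists_symm_sqrt hSig
  rw [h, integral_map (by fun_prop) (by fun_prop)]
  simp only [quadForm_toLp_mulVec hA]
  rw [integral_quadForm_stdGaussian (isHermitian_conj hA hG), mul_assoc, Matrix.trace_mul_comm,
    mul_assoc, hAA]

theorem variance_quadForm_multivariateGaussian (hSig : Sig.PosSemidef) (hG : G.IsSymm) :
    Var[quadForm G; multivariateGaussian 0 Sig] = 2 * (G * Sig * G * Sig).trace := by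
  obtain ⟨A, hA, hAA, h⟩ := exists_symm_sqrt hSig
  rw [h, variance_map (by fun_prop) (by fun_prop)]
  simp only [Function.comp_def, quadForm_toLp_mulVec hA]
  rw [variance_quadForm_stdGaussian (isHermitian_conj hA hG), ← hAA]
  congr 1
  rw [mul_assoc A G A, mul_assoc A, Matrix.trace_mul_comm]
  simp only [mul_assoc]

theorem quadForm_add_transpose (M : Matrix (Fin p) (Fin p) ℝ) (x : EuclideanSpace ℝ (Fin p)) :
    quadForm (M + Mᵀ) x = 2 * quadForm M x := by
  simp only [quadForm, Matrix.add_mulVec, dotProduct_add, Matrix.mulVec_transpose]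
  rw [dotProduct_comm x.ofLp (x.ofLp ᵥ* M), ← Matrix.dotProduct_mulVec]
  ring

/-- Symmetrisation is needed because the Fisher information varies single entries, and so produces
forms of nonsymmetric matrices. -/
theorem quadForm_eq_symmPart (M : Matrix (Fin p) (Fin p) ℝ) :
    quadForm M = fun x => 2⁻¹ * quadForm (M + Mᵀ) x := by
  ext x
  rw [quadForm_add_transpose]
  ring

theorem integrable_quadForm_multivariateGaussian (hSig : Sig.PosSemidef)
    (M : Matrix (Fin p) (Fin p) ℝ) : Integrable (quadForm M) (multivariateGaussian 0 Sig) := by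
  rw [quadForm_eq_symmPart]
  exact ((memLp_quadForm_multivariateGaussian hSig
    (Matrix.isSymm_add_transpose_self M)).integrable (by norm_num)).const_mul _

theorem integral_quadForm_multivariateGaussian' (hSig : Sig.PosSemidef)
    (M : Matrix (Fin p) (Fin p) ℝ) :
    ∫ x, quadForm M x ∂multivariateGaussian 0 Sig = (M * Sig).trace := by
  have hs : Sigᵀ = Sig := by
    have := hSig.isHermitian
    rwa [Matrix.IsHermitian, Matrix.conjTranspose_eq_transpose_of_trivial] at this
  rw [quadForm_eq_symmPart, integral_const_mul,
    integral_quadForm_multivariateGaussian hSig (Matrix.isSymm_add_transpose_self M), add_mul,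
    Matrix.trace_add]
  have : (Mᵀ * Sig).trace = (M * Sig).trace := by
    rw [← Matrix.trace_transpose, Matrix.transpose_mul, Matrix.transpose_transpose, hs,
      Matrix.trace_mul_comm]
  rw [this]
  ring

end Moments

end BlockCov

namespace BlockCov

/-! ### The Fisher information of the Gaussian model -/

section Fisher

open Topology

variable {p : ℕ} {A E : Matrix (Fin p) (Fin p) ℝ}

theorem continuous_add_smul (A E : Matrix (Fin p) (Fin p) ℝ) :
    Continuous fun t : ℝ => A + t • E := by fun_prop

theorem eventually_det_add_smul_pos (hA : 0 < A.det) :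
    ∀ᶠ t : ℝ in 𝓝 0, 0 < (A + t • E).det := by
  have h : ContinuousAt (fun t : ℝ => (A + t • E).det) 0 :=
    (continuous_add_smul A E).matrix_det.continuousAt
  exact h.eventually_const_lt (by simpa using hA)

/-- After factoring out `A.det`, the determinant of `1 + t M` is the polynomial `1 + t tr M + t²
q(t)`. -/
theorem hasDerivAt_log_det (hA : 0 < A.det) :
    HasDerivAt (fun t : ℝ => Real.log (A + t • E).det) (A⁻¹ * E).trace 0 := by
  have h1 : ∀ t : ℝ, (A + t • E).det = A.det * (1 + t • (A⁻¹ * E)).det := by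
    intro t
    rw [← Matrix.det_mul, mul_add, mul_one, Matrix.mul_smul, ← mul_assoc,
      Matrix.mul_nonsing_inv _ hA.ne'.isUnit, one_mul]
  have h2 : HasDerivAt (fun t : ℝ => (1 + t • (A⁻¹ * E)).det) (A⁻¹ * E).trace 0 := by
    rw [funext fun t : ℝ => Matrix.det_one_add_smul t (A⁻¹ * E)]
    set q := (Matrix.det (1 + (Polynomial.X : Polynomial ℝ) • (A⁻¹ * E).map Polynomial.C)).divX.divX
    have := ((((hasDerivAt_id' (0 : ℝ)).const_mul (A⁻¹ * E).trace).const_add 1).fun_add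
      ((q.hasDerivAt 0).fun_mul ((hasDerivAt_id' (0 : ℝ)).fun_pow 2)))
    simpa using this
  have h3 := (h2.const_mul A.det).log (by simpa using hA.ne')
  simp only [← h1] at h3
  convert! h3 using 1
  simp
  field_simp

/-- By the resolvent identity the difference quotient equals `-(A + tE)⁻¹ E A⁻¹`, so continuity of
inversion suffices. -/
theorem hasDerivAt_inv_apply (hA : 0 < A.det) (i j : Fin p) :
    HasDerivAt (fun t : ℝ => (A + t • E)⁻¹ i j) ((-(A⁻¹ * E * A⁻¹)) i j) 0 := by
  rw [hasDerivAt_iff_tendsto_slope_zero]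
  have hc : ContinuousAt (fun t : ℝ => (A + t • E)⁻¹) 0 := by
    have h : ContinuousAt Inv.inv (A + (0 : ℝ) • E) := by
      refine continuousAt_matrix_inv _ ?_
      have : (A + (0 : ℝ) • E).det ≠ 0 := by simpa using hA.ne'
      simpa only [Ring.inverse_eq_inv'] using continuousAt_inv₀ this
    exact ContinuousAt.comp (f := fun t : ℝ => A + t • E) h (continuous_add_smul A E).continuousAt
  have hlim : Tendsto (fun t : ℝ => (-((A + t • E)⁻¹ * E * A⁻¹)) i j) (𝓝 0)
      (𝓝 ((-(A⁻¹ * E * A⁻¹)) i j)) := by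
    have h1 : ContinuousAt (fun t : ℝ => -((A + t • E)⁻¹ * E * A⁻¹)) 0 := by fun_prop
    have h2 := tendsto_pi_nhds.1 (tendsto_pi_nhds.1 h1.tendsto i) j
    simpa using h2
  refine (hlim.mono_left nhdsWithin_le_nhds).congr' ?_
  filter_upwards [nhdsWithin_le_nhds (eventually_det_add_smul_pos (E := E) hA),
    self_mem_nhdsWithin] with t ht ht0
  have h : (A + t • E)⁻¹ - A⁻¹ = t • -((A + t • E)⁻¹ * E * A⁻¹) := by
    have : (A + t • E)⁻¹ - A⁻¹ = (A + t • E)⁻¹ * (A - (A + t • E)) * A⁻¹ := by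
      rw [mul_sub, sub_mul, Matrix.nonsing_inv_mul _ ht.ne'.isUnit, one_mul, mul_assoc,
        Matrix.mul_nonsing_inv _ hA.ne'.isUnit, mul_one]
    rw [this]
    simp
  have h' := congrFun (congrFun h i) j
  simp only [Matrix.sub_apply, Matrix.smul_apply, smul_eq_mul] at h'
  rw [zero_add, zero_smul, add_zero, h', smul_eq_mul, inv_mul_cancel_left₀ ht0]

/-- Entrywise derivative at `0` of a curve of matrices. -/
def HasEntryDeriv (F : ℝ → Matrix (Fin p) (Fin p) ℝ) (F' : Matrix (Fin p) (Fin p) ℝ) : Prop :=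
  ∀ i j, HasDerivAt (fun t => F t i j) (F' i j) 0

namespace HasEntryDeriv

variable {F H : ℝ → Matrix (Fin p) (Fin p) ℝ} {F' H' : Matrix (Fin p) (Fin p) ℝ}

theorem const (M : Matrix (Fin p) (Fin p) ℝ) : HasEntryDeriv (fun _ => M) 0 :=
  fun _ _ => hasDerivAt_const _ _

theorem mul (hF : HasEntryDeriv F F') (hH : HasEntryDeriv H H') :
    HasEntryDeriv (fun t => F t * H t) (F' * H 0 + F 0 * H') := by
  intro i j
  simp only [Matrix.mul_apply, Matrix.add_apply, ← Finset.sum_add_distrib]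
  exact HasDerivAt.fun_sum fun k _ => (hF i k).fun_mul (hH k j)

theorem trace (hF : HasEntryDeriv F F') : HasDerivAt (fun t => (F t).trace) F'.trace 0 :=
  HasDerivAt.fun_sum fun k _ => hF k k

theorem quadForm (hF : HasEntryDeriv F F') (x : EuclideanSpace ℝ (Fin p)) :
    HasDerivAt (fun t => BlockCov.quadForm (F t) x) (BlockCov.quadForm F' x) 0 := by
  simp only [BlockCov.quadForm, dotProduct, Matrix.mulVec]
  exact HasDerivAt.fun_sum fun i _ =>
    (HasDerivAt.fun_sum fun j _ => (hF i j).mul_const _).const_mul _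

end HasEntryDeriv

theorem hasEntryDeriv_inv (hA : 0 < A.det) :
    HasEntryDeriv (fun t : ℝ => (A + t • E)⁻¹) (-(A⁻¹ * E * A⁻¹)) :=
  fun i j => hasDerivAt_inv_apply hA i j

theorem log_gaussianDensity (hA : 0 < A.det) (x : EuclideanSpace ℝ (Fin p)) :
    Real.log (gaussianDensity A x) =
      -(1 / 2) * Real.log ((2 * Real.pi) ^ p) - 1 / 2 * Real.log A.det
        - 1 / 2 * quadForm A⁻¹ x := by
  have hc : 0 < (2 * Real.pi) ^ p := by positivity
  rw [gaussianDensity, Real.log_mul (by positivity) (Real.exp_pos _).ne', Real.log_exp,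
    one_div, Real.log_inv, Real.log_sqrt (by positivity), Real.log_mul hc.ne' hA.ne', quadForm]
  ring

theorem deriv_log_gaussianDensity (hA : 0 < A.det) (x : EuclideanSpace ℝ (Fin p)) :
    deriv (fun t : ℝ => Real.log (gaussianDensity (A + t • E) x)) 0 =
      -(1 / 2) * (A⁻¹ * E).trace + 1 / 2 * quadForm (A⁻¹ * E * A⁻¹) x := by
  have h1 : (fun t : ℝ => Real.log (gaussianDensity (A + t • E) x)) =ᶠ[𝓝 0] fun t =>
      -(1 / 2) * Real.log ((2 * Real.pi) ^ p) - 1 / 2 * Real.log (A + t • E).det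
        - 1 / 2 * quadForm (A + t • E)⁻¹ x :=
    (eventually_det_add_smul_pos hA).mono fun t ht => log_gaussianDensity ht x
  rw [h1.deriv_eq, ((((hasDerivAt_log_det hA).const_mul (1 / 2)).const_sub _).fun_sub
    (((hasEntryDeriv_inv hA).quadForm x).const_mul (1 / 2))).deriv]
  have : quadForm (-(A⁻¹ * E * A⁻¹)) x = -quadForm (A⁻¹ * E * A⁻¹) x := by
    simp [quadForm, Matrix.neg_mulVec]
  rw [this]
  ring

theorem deriv_deriv_log_gaussianDensity (hA : 0 < A.det) (E' : Matrix (Fin p) (Fin p) ℝ)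
    (x : EuclideanSpace ℝ (Fin p)) :
    deriv (fun s : ℝ => deriv (fun t : ℝ =>
      Real.log (gaussianDensity (A + s • E + t • E') x)) 0) 0 =
      1 / 2 * (A⁻¹ * E * A⁻¹ * E').trace
        - 1 / 2 * quadForm (A⁻¹ * E * A⁻¹ * E' * A⁻¹ + A⁻¹ * E' * (A⁻¹ * E * A⁻¹)) x := by
  have h1 : (fun s : ℝ => deriv (fun t : ℝ =>
      Real.log (gaussianDensity (A + s • E + t • E') x)) 0) =ᶠ[𝓝 0] fun s =>
      -(1 / 2) * ((A + s • E)⁻¹ * E').trace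
        + 1 / 2 * quadForm ((A + s • E)⁻¹ * E' * (A + s • E)⁻¹) x :=
    (eventually_det_add_smul_pos hA).mono fun s hs => deriv_log_gaussianDensity hs x
  have hi := hasEntryDeriv_inv (E := E) hA
  have hi2 := hi.mul (HasEntryDeriv.const E')
  have h2 := ((hi2.trace.const_mul (-(1 / 2))).fun_add
    (((hi2.mul hi).quadForm x).const_mul (1 / 2))).deriv
  rw [h1.deriv_eq, h2]
  have : quadForm ((-(A⁻¹ * E * A⁻¹) * E' + (A + (0 : ℝ) • E)⁻¹ * 0) * (A + (0 : ℝ) • E)⁻¹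
      + (A + (0 : ℝ) • E)⁻¹ * E' * -(A⁻¹ * E * A⁻¹)) x
      = -quadForm (A⁻¹ * E * A⁻¹ * E' * A⁻¹ + A⁻¹ * E' * (A⁻¹ * E * A⁻¹)) x := by
    have e : (-(A⁻¹ * E * A⁻¹) * E' + (A + (0 : ℝ) • E)⁻¹ * 0) * (A + (0 : ℝ) • E)⁻¹
        + (A + (0 : ℝ) • E)⁻¹ * E' * -(A⁻¹ * E * A⁻¹)
        = -(A⁻¹ * E * A⁻¹ * E' * A⁻¹ + A⁻¹ * E' * (A⁻¹ * E * A⁻¹)) := by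
      rw [zero_smul, add_zero, mul_zero, add_zero, neg_mul, neg_mul, mul_neg, neg_add]
    rw [e, quadForm, Matrix.neg_mulVec, dotProduct_neg, quadForm]
  rw [this]
  simp
  ring

theorem unvec_add_smul (θ : Fin p × Fin p → ℝ) (v : Fin p × Fin p → ℝ) (s : ℝ) :
    unvec (θ + s • v) = unvec θ + s • unvec v := rfl

/-- The two terms of the quadratic form have the same mean, so the expected Hessian is `½ - 1 = -½`
times the trace. -/
theorem gaussianFisher_apply {Sig : Matrix (Fin p) (Fin p) ℝ} (hSig : Sig.PosDef)
    (a b : Fin p × Fin p) :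
    gaussianFisher Sig a b =
      1 / 2 * (Sig⁻¹ * unvec (Pi.single a 1) * Sig⁻¹ * unvec (Pi.single b 1)).trace := by
  simp only [gaussianFisher, fisherInformation, Matrix.of_apply, unvec_add_smul, unvec_vec,
    deriv_deriv_log_gaussianDensity hSig.det_pos]
  set M := unvec (Pi.single a (1 : ℝ)) with hM
  set N := unvec (Pi.single b (1 : ℝ)) with hN
  rw [integral_sub (integrable_const _)
    ((integrable_quadForm_multivariateGaussian hSig.posSemidef _).const_mul _),
    integral_const_mul, integral_const_mul, integral_quadForm_multivariateGaussian' hSig.posSemidef, integral_const,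
    probReal_univ, one_smul, add_mul, Matrix.trace_add]
  have hu := Matrix.nonsing_inv_mul Sig hSig.det_pos.ne'.isUnit
  have e1 : Sig⁻¹ * M * Sig⁻¹ * N * Sig⁻¹ * Sig = Sig⁻¹ * M * Sig⁻¹ * N := by
    rw [mul_assoc _ Sig⁻¹ Sig, hu, mul_one]
  have e2 : (Sig⁻¹ * N * (Sig⁻¹ * M * Sig⁻¹) * Sig).trace = (Sig⁻¹ * M * Sig⁻¹ * N).trace := by
    rw [mul_assoc _ _ Sig, mul_assoc _ Sig⁻¹ Sig, hu, mul_one, Matrix.trace_mul_comm, ← mul_assoc]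
  rw [e1, e2]
  ring

/-- The transpose appears because the information pairs matrices by `tr(AB)`, the vectorisations by
`tr(AᵀB)`. It disappears for symmetric `W`. -/
theorem gaussianFisher_mulVec_vec {Sig : Matrix (Fin p) (Fin p) ℝ} (hSig : Sig.PosDef)
    (W : Matrix (Fin p) (Fin p) ℝ) :
    gaussianFisher Sig *ᵥ W.vec = (1 / 2 : ℝ) • (Sig⁻¹ * W * Sig⁻¹)ᵀ.vec := by
  have hs : ∀ b : Fin p × Fin p, unvec (Pi.single b (1 : ℝ)) = Matrix.single b.2 b.1 1 := by
    intro b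
    ext i j
    simp only [unvec, Matrix.of_apply, Matrix.single_apply, Pi.single_apply, Prod.ext_iff]
    congr 1
    exact propext ⟨fun h => ⟨h.2.symm, h.1.symm⟩, fun h => ⟨h.2.symm, h.1.symm⟩⟩
  have ht : ∀ k l i j : Fin p,
      (Sig⁻¹ * Matrix.single l k 1 * Sig⁻¹ * Matrix.single j i 1).trace
        = Sig⁻¹ k j * Sig⁻¹ i l := by
    intro k l i j
    rw [Matrix.trace_mul_single, Matrix.mul_apply]
    simp [Matrix.mul_apply, Matrix.single_apply, mul_comm, ite_and]
  ext ⟨k, l⟩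
  simp only [Matrix.mulVec, dotProduct, gaussianFisher_apply hSig, hs, Pi.smul_apply,
    smul_eq_mul, Matrix.vec, Matrix.transpose_apply, Matrix.mul_apply, Fintype.sum_prod_type,
    Finset.sum_mul, Finset.mul_sum]
  refine Finset.sum_congr rfl fun i _ => Finset.sum_congr rfl fun j _ => ?_
  rw [ht]
  ring

end Fisher

/-! ### The constrained Cramér-Rao bound -/

section CramerRao

variable {d : Type*} [Fintype d] {J K : Matrix d d ℝ} {V : Submodule ℝ (EuclideanSpace ℝ d)}

/-- `K` only has to invert `J` on `V`. As `U Uᵀ` fixes the columns of `K U`, the matrix `Uᵀ K U` is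
the inverse of `Uᵀ J U`. The projection `R = U Uᵀ` is described by its action on `V` and on its
orthogonal complement, so that no basis remains. -/
theorem constrainedCRBound_eq [DecidableEq d] (hK : ∀ v ∈ V, WithLp.toLp 2 (K *ᵥ v.ofLp) ∈ V)
    (hJK : ∀ v ∈ V, J *ᵥ (K *ᵥ v.ofLp) = v.ofLp) :
    ∃ R : Matrix d d ℝ, Rᵀ = R ∧ constrainedCRBound J V = R * K * R ∧
      (∀ v ∈ V, R *ᵥ v.ofLp = v.ofLp) ∧
      ∀ t, (∀ v ∈ V, t ⬝ᵥ v.ofLp = 0) → R *ᵥ t = 0 := by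
  set b := stdOrthonormalBasis ℝ V
  set U : Matrix d (Fin (Module.finrank ℝ V)) ℝ :=
    Matrix.of fun a k => (b k : EuclideanSpace ℝ d) a with hU
  have hinner : ∀ x y : EuclideanSpace ℝ d, inner ℝ x y = x.ofLp ⬝ᵥ y.ofLp := by
    intro x y
    rw [EuclideanSpace.inner_eq_star_dotProduct, star_trivial, dotProduct_comm]
  have hUU : Uᵀ * U = 1 := by
    ext k l
    have := (orthonormal_iff_ite.1 b.orthonormal) k l
    rw [Submodule.coe_inner, hinner] at this
    rw [Matrix.mul_apply, Matrix.one_apply, ← this]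
    rfl
  have hproj : ∀ v ∈ V, (U * Uᵀ) *ᵥ v.ofLp = v.ofLp := by
    intro v hv
    have h := congrArg (fun w : V => (w : EuclideanSpace ℝ d).ofLp) (b.sum_repr' ⟨v, hv⟩)
    simp only [Submodule.coe_sum, Submodule.coe_smul, WithLp.ofLp_sum, WithLp.ofLp_smul,
      Submodule.coe_inner, hinner] at h
    rw [← Matrix.mulVec_mulVec]
    conv_rhs => rw [← h]
    ext a
    simp only [Matrix.mulVec, dotProduct, Finset.sum_apply, Pi.smul_apply, smul_eq_mul,
      Matrix.transpose_apply, hU, Matrix.of_apply]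
    exact Finset.sum_congr rfl fun k _ => mul_comm _ _
  have hcol : ∀ k, (fun a => U a k) = (b k : EuclideanSpace ℝ d).ofLp := fun k => rfl
  have hKU : U * Uᵀ * (K * U) = K * U := by
    ext a k
    have := congrFun (hproj _ (hK _ (b k).2)) a
    simp only [← hcol] at this
    exact this
  have hJKU : J * (K * U) = U := by
    ext a k
    have := congrFun (hJK _ (b k).2) a
    simp only [← hcol] at this
    exact this
  have hinv : (Uᵀ * J * U)⁻¹ = Uᵀ * K * U := by
    refine Matrix.inv_eq_right_inv ?_
    calc Uᵀ * J * U * (Uᵀ * K * U) = Uᵀ * (J * (U * Uᵀ * (K * U))) := by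
          simp only [Matrix.mul_assoc]
      _ = 1 := by rw [hKU, hJKU, hUU]
  refine ⟨U * Uᵀ, by rw [Matrix.transpose_mul, Matrix.transpose_transpose], ?_, hproj, ?_⟩
  · change U * (Uᵀ * J * U)⁻¹ * Uᵀ = _
    rw [hinv]
    simp only [Matrix.mul_assoc]
  · intro t ht
    rw [← Matrix.mulVec_mulVec]
    have : Uᵀ *ᵥ t = 0 := by
      ext k
      have := ht _ (b k).2
      rw [dotProduct_comm] at this
      exact this
    rw [this, Matrix.mulVec_zero]

variable {p : ℕ} {B : Setoid (Fin p)} {Sig : Matrix (Fin p) (Fin p) ℝ}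

/-- The matrix of `W ↦ 2 Sig W Sig` on vectorised matrices. -/
def sandwich (Sig : Matrix (Fin p) (Fin p) ℝ) : Matrix (Fin p × Fin p) (Fin p × Fin p) ℝ :=
  Matrix.of fun a b => 2 * Sig a.2 b.2 * Sig b.1 a.1

theorem sandwich_mulVec_vec (W : Matrix (Fin p) (Fin p) ℝ) :
    sandwich Sig *ᵥ W.vec = (2 : ℝ) • (Sig * W * Sig).vec := by
  ext ⟨k, l⟩
  simp only [Matrix.mulVec, dotProduct, sandwich, Matrix.of_apply, Pi.smul_apply, smul_eq_mul,
    Matrix.vec, Matrix.mul_apply, Fintype.sum_prod_type, Finset.sum_mul, Finset.mul_sum]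
  refine Finset.sum_congr rfl fun i _ => Finset.sum_congr rfl fun j _ => ?_
  ring

theorem vec_dotProduct_vec (W G : Matrix (Fin p) (Fin p) ℝ) :
    W.vec ⬝ᵥ G.vec = (Wᵀ * G).trace := by
  simp only [Matrix.vec, dotProduct, Matrix.trace, Matrix.diag, Matrix.mul_apply,
    Matrix.transpose_apply, Fintype.sum_prod_type]

/-- The orthogonal projection of a matrix on the symmetric matrices with block structure `B`. -/
noncomputable def symmBlock (B : Setoid (Fin p)) (T : Matrix (Fin p) (Fin p) ℝ) :
    Matrix (Fin p) (Fin p) ℝ :=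
  (2⁻¹ : ℝ) • blockPart B (T + Tᵀ)

theorem isSymm_symmBlock (T : Matrix (Fin p) (Fin p) ℝ) : (symmBlock B T).IsSymm := by
  rw [symmBlock, Matrix.IsSymm, Matrix.transpose_smul, blockPart_transpose, Matrix.transpose_add,
    Matrix.transpose_transpose, add_comm]

theorem blockPart_symmBlock (T : Matrix (Fin p) (Fin p) ℝ) :
    blockPart B (symmBlock B T) = symmBlock B T := by
  rw [symmBlock, blockPart_smul, blockPart_idem]

theorem trace_symmBlock_mul (T : Matrix (Fin p) (Fin p) ℝ) {W : Matrix (Fin p) (Fin p) ℝ}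
    (hW : W.IsSymm) (hB : blockPart B W = W) : (symmBlock B T * W).trace = (Tᵀ * W).trace := by
  have h : (T * W).trace = (Tᵀ * W).trace := by
    rw [← Matrix.trace_transpose, Matrix.transpose_mul, hW.eq, Matrix.trace_mul_comm]
  rw [symmBlock, Matrix.smul_mul, Matrix.trace_smul, Matrix.trace_mul_comm, trace_mul_blockPart hB,
    Matrix.trace_mul_comm, add_mul, Matrix.trace_add, h, smul_eq_mul]
  ring

theorem isSymm_conj {W : Matrix (Fin p) (Fin p) ℝ} (hSig : Sig.IsSymm) (hW : W.IsSymm) :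
    (Sig * W * Sig).IsSymm := by
  rw [Matrix.IsSymm, Matrix.transpose_mul, Matrix.transpose_mul, hSig.eq, hW.eq, mul_assoc]

theorem isSymm_of_posDef (hSig : Sig.PosDef) : Sig.IsSymm := by
  have := hSig.isHermitian
  rwa [Matrix.IsHermitian, Matrix.conjTranspose_eq_transpose_of_trivial] at this

theorem exists_CR_eq (hSig : Sig.PosDef) (hB : blockPart B Sig = Sig) :
    ∃ R : Matrix (Fin p × Fin p) (Fin p × Fin p) ℝ, Rᵀ = R ∧ CR Sig B = R * sandwich Sig * R ∧
      (∀ v ∈ structureSpace B, R *ᵥ v.ofLp = v.ofLp) ∧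
      ∀ t, (∀ v ∈ structureSpace B, t ⬝ᵥ v.ofLp = 0) → R *ᵥ t = 0 := by
  have hs := isSymm_of_posDef hSig
  refine constrainedCRBound_eq (K := sandwich Sig) ?_ ?_
  · rintro _ ⟨W, hW, hWB, rfl⟩
    refine ⟨(2 : ℝ) • (Sig * W * Sig), (isSymm_conj hs hW).smul _, ?_, ?_⟩
    · rw [blockPart_smul, blockPart_mul_eq_self (blockPart_mul_eq_self hB hWB) hB]
    · simp only [vecE, sandwich_mulVec_vec]
      rfl
  · rintro _ ⟨W, hW, hWB, rfl⟩
    simp only [vecE, sandwich_mulVec_vec, Matrix.mulVec_smul, gaussianFisher_mulVec_vec hSig]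
    have h1 : Sig⁻¹ * (Sig * W * Sig) * Sig⁻¹ = W := by
      rw [mul_assoc Sig, ← mul_assoc, Matrix.nonsing_inv_mul _ hSig.det_pos.ne'.isUnit, one_mul,
        mul_assoc, Matrix.mul_nonsing_inv _ hSig.det_pos.ne'.isUnit, mul_one]
    rw [h1, hW.eq, smul_smul]
    norm_num

/-- The heart of efficiency: the right side is the variance of the quadratic form of `symmBlock B T`
under `N(0, Sig)`, that is, the asymptotic variance of the oracle in direction `T`. -/
theorem CR_mulVec (hSig : Sig.PosDef) (hB : blockPart B Sig = Sig)
    (T : Matrix (Fin p) (Fin p) ℝ) :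
    T.vec ⬝ᵥ CR Sig B *ᵥ T.vec = 2 * (symmBlock B T * Sig * symmBlock B T * Sig).trace := by
  obtain ⟨R, hR, hCR, hfix, hzero⟩ := exists_CR_eq hSig hB
  have hG := isSymm_symmBlock (B := B) T
  have hGB := blockPart_symmBlock (B := B) T
  have h1 : R *ᵥ T.vec = (symmBlock B T).vec := by
    have h2 : R *ᵥ (T.vec - (symmBlock B T).vec) = 0 := by
      refine hzero _ ?_
      rintro _ ⟨W, hW, hWB, rfl⟩
      simp only [vecE]
      rw [sub_dotProduct, vec_dotProduct_vec, vec_dotProduct_vec, hG.eq,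
        trace_symmBlock_mul T hW hWB, sub_self]
    rw [Matrix.mulVec_sub, sub_eq_zero] at h2
    rw [h2]
    exact hfix (vecE _) ⟨_, hG, hGB, rfl⟩
  rw [hCR, ← Matrix.mulVec_mulVec, ← Matrix.mulVec_mulVec, Matrix.dotProduct_mulVec,
    ← Matrix.mulVec_transpose, hR, h1, sandwich_mulVec_vec, dotProduct_smul, vec_dotProduct_vec,
    hG.eq, smul_eq_mul]
  simp only [mul_assoc]

open scoped MatrixOrder in
/-- `tr (G Sig G Sig)` is a squared Frobenius norm. -/
theorem trace_sandwich_eq (hSig : Sig.PosDef) (G : Matrix (Fin p) (Fin p) ℝ) (hG : G.IsSymm) :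
    ∃ A : Matrix (Fin p) (Fin p) ℝ, IsUnit A ∧
      (G * Sig * G * Sig).trace = ((A * G * Aᴴ)ᴴ * (A * G * Aᴴ)).trace := by
  obtain ⟨A, hA⟩ := CStarAlgebra.nonneg_iff_eq_star_mul_self.mp hSig.posSemidef.nonneg
  rw [Matrix.star_eq_conjTranspose] at hA
  refine ⟨A, ?_, ?_⟩
  · have := hSig.det_pos
    rw [hA, Matrix.det_mul] at this
    exact (Matrix.isUnit_iff_isUnit_det A).2 (right_ne_zero_of_mul this.ne').isUnit
  · have hGc : Gᴴ = G := by rw [Matrix.conjTranspose_eq_transpose_of_trivial, hG.eq]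
    rw [Matrix.conjTranspose_mul, Matrix.conjTranspose_mul, Matrix.conjTranspose_conjTranspose, hGc,
      hA, ← mul_assoc, Matrix.trace_mul_comm _ A]
    simp only [mul_assoc]

theorem trace_sandwich_nonneg (hSig : Sig.PosDef) (G : Matrix (Fin p) (Fin p) ℝ)
    (hG : G.IsSymm) : 0 ≤ (G * Sig * G * Sig).trace := by
  obtain ⟨A, -, h⟩ := trace_sandwich_eq hSig G hG
  rw [h]
  exact (Matrix.posSemidef_conjTranspose_mul_self _).trace_nonneg

theorem trace_sandwich_pos (hSig : Sig.PosDef) (G : Matrix (Fin p) (Fin p) ℝ)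
    (hG : G.IsSymm) (h0 : G ≠ 0) : 0 < (G * Sig * G * Sig).trace := by
  refine (trace_sandwich_nonneg hSig G hG).lt_of_ne' fun h => h0 ?_
  obtain ⟨A, hA, hA'⟩ := trace_sandwich_eq hSig G hG
  rw [h, eq_comm, Matrix.trace_conjTranspose_mul_self_eq_zero_iff] at hA'
  have hAc : IsUnit Aᴴ := hA.star
  rwa [hAc.mul_left_eq_zero, hA.mul_right_eq_zero] at hA'

theorem posSemidef_CR (hSig : Sig.PosDef) (hB : blockPart B Sig = Sig) :
    (CR Sig B).PosSemidef := by
  refine Matrix.PosSemidef.of_dotProduct_mulVec_nonneg ?_ fun t => ?_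
  · obtain ⟨R, hR, hCR, -⟩ := exists_CR_eq hSig hB
    have hs := isSymm_of_posDef hSig
    have hK : (sandwich Sig)ᵀ = sandwich Sig := by
      ext a b
      simp only [sandwich, Matrix.transpose_apply, Matrix.of_apply, hs.apply a.2 b.2,
        hs.apply b.1 a.1]
    rw [Matrix.IsHermitian, Matrix.conjTranspose_eq_transpose_of_trivial, hCR,
      Matrix.transpose_mul, Matrix.transpose_mul, hR, hK, mul_assoc]
  · rw [star_trivial]
    have h : (unvec t).vec = t := rfl
    rw [← h, CR_mulVec hSig hB]
    exact mul_nonneg zero_le_two (trace_sandwich_nonneg hSig _ (isSymm_symmBlock _))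

end CramerRao

end BlockCov

namespace BlockCov

/-! ### The central limit theorem for the empirical covariance matrix -/

section Algebra

variable {p : ℕ}

/-- The rank one matrix `x xᵀ`. -/
def outer (x : EuclideanSpace ℝ (Fin p)) : Matrix (Fin p) (Fin p) ℝ :=
  Matrix.vecMulVec x.ofLp x.ofLp

theorem isSymm_outer (x : EuclideanSpace ℝ (Fin p)) : (outer x).IsSymm :=
  Matrix.transpose_vecMulVec _ _

theorem trace_mul_outer (G : Matrix (Fin p) (Fin p) ℝ) (x : EuclideanSpace ℝ (Fin p)) :
    (G * outer x).trace = quadForm G x := by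
  rw [outer, Matrix.mul_vecMulVec, Matrix.trace_vecMulVec, quadForm, dotProduct_comm]

theorem inner_vecE (W T : Matrix (Fin p) (Fin p) ℝ) :
    inner ℝ (vecE W) (vecE T) = (Wᵀ * T).trace := by
  rw [EuclideanSpace.inner_eq_star_dotProduct, star_trivial, dotProduct_comm]
  exact vec_dotProduct_vec W T

/-- Self-adjointness of the projection: it moves from the empirical matrix to the direction `t`,
leaving a trace that is linear in the unprojected matrix. -/
theorem inner_vecE_blockPart {B : Setoid (Fin p)} {W : Matrix (Fin p) (Fin p) ℝ} (hW : W.IsSymm)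
    (t : EuclideanSpace ℝ (Fin p × Fin p)) :
    inner ℝ (vecE (blockPart B W)) t = (symmBlock B (unvec t.ofLp) * W).trace := by
  have hWs : (blockPart B W).IsSymm := by rw [Matrix.IsSymm, blockPart_transpose, hW.eq]
  rw [← trace_mul_blockPart (blockPart_symmBlock _), trace_symmBlock_mul _ hWs blockPart_idem,
    ← inner_vecE, real_inner_comm, vecE_unvec]

theorem vecE_add (A C : Matrix (Fin p) (Fin p) ℝ) : vecE (A + C) = vecE A + vecE C := rfl

theorem vecE_sub (A C : Matrix (Fin p) (Fin p) ℝ) : vecE (A - C) = vecE A - vecE C := rfl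

theorem vecE_smul (c : ℝ) (A : Matrix (Fin p) (Fin p) ℝ) : vecE (c • A) = c • vecE A := rfl

theorem empMean_sub {n : ℕ} (hn : n ≠ 0) (x : ℕ → EuclideanSpace ℝ (Fin p))
    (m : EuclideanSpace ℝ (Fin p)) : empMean n (fun l => x l - m) = empMean n x - m := by
  have hn' : (n : ℝ) ≠ 0 := Nat.cast_ne_zero.2 hn
  rw [empMean, Finset.sum_sub_distrib, Finset.sum_const, Finset.card_range, smul_sub,
    ← Nat.cast_smul_eq_nsmul ℝ, smul_smul, inv_mul_cancel₀ hn', one_smul, empMean]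

theorem empCov_eq_sub {n : ℕ} (hn : n ≠ 0) (z : ℕ → EuclideanSpace ℝ (Fin p)) :
    empCov n z = (n : ℝ)⁻¹ • ∑ l ∈ Finset.range n, outer (z l) - outer (empMean n z) := by
  have hn' : (n : ℝ) ≠ 0 := Nat.cast_ne_zero.2 hn
  ext i j
  have hm : ∀ i, (empMean n z) i = (n : ℝ)⁻¹ * ∑ l ∈ Finset.range n, z l i := by
    intro i; simp [empMean]
  simp only [empCov, outer, Matrix.smul_apply, Matrix.sub_apply, Matrix.sum_apply,
    Matrix.vecMulVec_apply, WithLp.ofLp_sub, Pi.sub_apply, smul_eq_mul, sub_mul, mul_sub,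
    Finset.sum_sub_distrib, Finset.sum_const, Finset.card_range, nsmul_eq_mul, ← Finset.mul_sum,
    ← Finset.sum_mul]
  have h1 : ∀ i, ∑ l ∈ Finset.range n, z l i = n * (empMean n z) i := by
    intro i; rw [hm]; field_simp
  rw [h1, h1]
  field_simp
  ring

theorem empCov_sub_const {n : ℕ} (hn : n ≠ 0) (x : ℕ → EuclideanSpace ℝ (Fin p))
    (m : EuclideanSpace ℝ (Fin p)) : empCov n (fun l => x l - m) = empCov n x := by
  simp only [empCov, empMean_sub hn, sub_sub_sub_cancel_right]

theorem norm_vecE_blockPart_outer_le (B : Setoid (Fin p)) (x : EuclideanSpace ℝ (Fin p)) :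
    ‖vecE (blockPart B (outer x))‖ ≤ ‖x‖ ^ 2 := by
  refine (sq_le_sq₀ (norm_nonneg _) (by positivity)).1 ?_
  rw [EuclideanSpace.real_norm_sq_eq, EuclideanSpace.real_norm_sq_eq, sq (∑ i, x i ^ 2),
    Finset.sum_mul_sum, Fintype.sum_prod_type]
  refine Finset.sum_le_sum fun j _ => Finset.sum_le_sum fun i _ => ?_
  change (blockPart B (outer x) i j) ^ 2 ≤ _
  by_cases h : B i j
  · rw [blockPart_of_rel h, outer, Matrix.vecMulVec_apply]
    exact le_of_eq (by ring)
  · rw [blockPart_of_not_rel h]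
    simp only [ne_eq, OfNat.ofNat_ne_zero, not_false_eq_true, zero_pow]
    positivity

theorem posSemidef_empCov (n : ℕ) (x : ℕ → EuclideanSpace ℝ (Fin p)) :
    (empCov n x).PosSemidef := by
  refine Matrix.PosSemidef.smul (Matrix.posSemidef_sum _ fun l _ => ?_) (by positivity)
  simpa using Matrix.posSemidef_vecMulVec_self_star (x l - empMean n x).ofLp

end Algebra

/-! ### Scalar projections, Lévy continuity and removal of the empirical mean. -/

section CLT

open Topology

variable {Ω : Type*} [MeasurableSpace Ω] {P : Measure Ω} {p : ℕ}
  {Sig : Matrix (Fin p) (Fin p) ℝ} {B : Setoid (Fin p)} {Z : ℕ → Ω → EuclideanSpace ℝ (Fin p)}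

theorem aemeasurable_vecE_blockPart {α : Type*} [MeasurableSpace α] (B : Setoid (Fin p))
    {F : α → Matrix (Fin p) (Fin p) ℝ} {ν : Measure α}
    (hF : ∀ i j, AEMeasurable (fun a => F a i j) ν) :
    AEMeasurable (fun a => vecE (blockPart B (F a))) ν := by
  refine (WithLp.measurable_toLp 2 _).comp_aemeasurable (aemeasurable_pi_lambda _ fun q => ?_)
  by_cases h : B q.2 q.1
  · exact (hF q.2 q.1).congr (ae_of_all _ fun a => (blockPart_of_rel h).symm)
  · exact aemeasurable_const.congr (ae_of_all _ fun a => (blockPart_of_not_rel h).symm)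

theorem aemeasurable_outer {α : Type*} [MeasurableSpace α] {ν : Measure α}
    {x : α → EuclideanSpace ℝ (Fin p)} (hx : AEMeasurable x ν) (i j : Fin p) :
    AEMeasurable (fun a => outer (x a) i j) ν := by
  simp only [outer, Matrix.vecMulVec_apply]
  fun_prop

theorem aemeasurable_empMean {x : ℕ → Ω → EuclideanSpace ℝ (Fin p)}
    (hx : ∀ l, AEMeasurable (x l) P) (n : ℕ) :
    AEMeasurable (fun ω => empMean n fun l => x l ω) P := by
  simp only [empMean]
  fun_prop

theorem aemeasurable_empCov {x : ℕ → Ω → EuclideanSpace ℝ (Fin p)}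
    (hx : ∀ l, AEMeasurable (x l) P) (n : ℕ) (i j : Fin p) :
    AEMeasurable (fun ω => empCov n (fun l => x l ω) i j) P := by
  have hm := aemeasurable_empMean hx n
  simp only [empCov, Matrix.smul_apply, Matrix.sum_apply, Matrix.vecMulVec_apply]
  have h : ∀ l, AEMeasurable (fun ω => (x l ω - empMean n fun l => x l ω) i
      * (x l ω - empMean n fun l => x l ω) j) P := by
    intro l
    have := hx l
    fun_prop
  exact (Finset.aemeasurable_fun_sum (Finset.range n) fun l _ => h l).const_smul (n : ℝ)⁻¹

theorem charFun_map_eq_charFun_inner {W : Ω → EuclideanSpace ℝ (Fin p × Fin p)}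
    (hW : AEMeasurable W P) (t : EuclideanSpace ℝ (Fin p × Fin p)) :
    charFun (P.map W) t = charFun (P.map fun ω => inner ℝ (W ω) t) 1 := by
  rw [charFun_apply, charFun_apply_real, integral_map hW (by fun_prop),
    integral_map (by fun_prop) (by fun_prop)]
  simp

variable [IsProbabilityMeasure P]

/-- In each direction `t` the statistic is a normalised sum of i.i.d. quadratic forms, so the scalar
central limit theorem applies; `CR_mulVec` identifies its variance with that of the limit. -/
theorem tendstoInDistribution_sum_outer (hSig : Sig.PosDef) (hB : blockPart B Sig = Sig)
    (hZ : ∀ l, HasLaw (Z l) (multivariateGaussian 0 Sig) P) (hindep : iIndepFun Z P) :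
    TendstoInDistribution (fun (n : ℕ) ω => √(n : ℝ) •
        (vecE (blockPart B ((n : ℝ)⁻¹ • ∑ l ∈ Finset.range n, outer (Z l ω))) - vecE Sig))
      atTop id (fun _ => P) (multivariateGaussian 0 (CR Sig B)) := by
  have hmeas : ∀ n : ℕ, AEMeasurable (fun ω => √(n : ℝ) •
      (vecE (blockPart B ((n : ℝ)⁻¹ • ∑ l ∈ Finset.range n, outer (Z l ω))) - vecE Sig)) P := by
    intro n
    have h : ∀ i j, AEMeasurable
        (fun ω => ((n : ℝ)⁻¹ • ∑ l ∈ Finset.range n, outer (Z l ω)) i j) P := by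
      intro i j
      simp only [Matrix.smul_apply, Matrix.sum_apply]
      exact (Finset.aemeasurable_fun_sum (Finset.range n) fun l _ =>
        aemeasurable_outer (hZ l).aemeasurable i j).const_smul (n : ℝ)⁻¹
    exact ((aemeasurable_vecE_blockPart B h).sub_const (vecE Sig)).const_smul (√(n : ℝ))
  refine ⟨hmeas, aemeasurable_id, ProbabilityMeasure.tendsto_iff_tendsto_charFun.2 fun t => ?_⟩
  set G := symmBlock B (unvec t.ofLp) with hG
  have hGs : G.IsSymm := isSymm_symmBlock _
  have hq : ∀ l, HasLaw (fun ω => quadForm G (Z l ω))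
      ((multivariateGaussian 0 Sig).map (quadForm G)) P := fun l =>
    HasLaw.fun_comp ⟨by fun_prop, rfl⟩ (hZ l)
  have hmean : P[fun ω => quadForm G (Z 0 ω)] = (G * Sig).trace := by
    rw [← integral_quadForm_multivariateGaussian hSig.posSemidef hGs]
    exact (hZ 0).integral_comp (f := quadForm G) (by fun_prop)
  have hvar : Var[fun ω => quadForm G (Z 0 ω); P] = t.ofLp ⬝ᵥ CR Sig B *ᵥ t.ofLp := by
    have h1 : t.ofLp ⬝ᵥ CR Sig B *ᵥ t.ofLp = 2 * (G * Sig * G * Sig).trace :=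
      CR_mulVec hSig hB (unvec t.ofLp)
    rw [h1, ← variance_quadForm_multivariateGaussian hSig.posSemidef hGs, ← (hZ 0).map_eq,
      variance_map (by fun_prop) (hZ 0).aemeasurable]
    rfl
  have hL2 : MemLp (fun ω => quadForm G (Z 0 ω)) 2 P := by
    have := memLp_quadForm_multivariateGaussian hSig.posSemidef hGs
    rw [← (hZ 0).map_eq] at this
    exact (memLp_map_measure_iff (by fun_prop) (hZ 0).aemeasurable).1 this
  have hclt := tendstoInDistribution_inv_sqrt_mul_sum_sub (Y := id)
    (P' := gaussianReal 0 Var[fun ω => quadForm G (Z 0 ω); P].toNNReal)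
    (X := fun l ω => quadForm G (Z l ω)) HasLaw.id hL2
    (hindep.comp (fun _ => quadForm G) fun _ => continuous_quadForm.measurable)
    (fun l => ⟨(hq l).aemeasurable, (hq 0).aemeasurable, (hq l).map_eq.trans (hq 0).map_eq.symm⟩)
  have hchar := ProbabilityMeasure.tendsto_iff_tendsto_charFun.1 hclt.tendsto 1
  have hinner : ∀ (n : ℕ) ω, inner ℝ (√(n : ℝ) •
      (vecE (blockPart B ((n : ℝ)⁻¹ • ∑ l ∈ Finset.range n, outer (Z l ω))) - vecE Sig)) t
      = (√(n : ℝ))⁻¹ * (∑ l ∈ Finset.range n, quadForm G (Z l ω)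
          - n * P[fun ω => quadForm G (Z 0 ω)]) := by
    intro n ω
    -- For `n = 0` both sides vanish, because `√0` and its inverse are `0`.
    rcases eq_or_ne n 0 with rfl | hn
    · simp
    have hn' : (0 : ℝ) < n := by positivity
    have hsym : ((n : ℝ)⁻¹ • ∑ l ∈ Finset.range n, outer (Z l ω)).IsSymm := by
      refine Matrix.IsSymm.smul ?_ _
      rw [Matrix.IsSymm, Matrix.transpose_sum]
      exact Finset.sum_congr rfl fun l _ => isSymm_outer _
    have h2 : inner ℝ (vecE Sig) t = (G * Sig).trace := by
      conv_lhs => rw [← hB]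
      exact inner_vecE_blockPart (isSymm_of_posDef hSig) t
    rw [real_inner_smul_left, inner_sub_left, inner_vecE_blockPart hsym, h2, hmean,
      Matrix.mul_smul, Matrix.trace_smul, Finset.mul_sum, Matrix.trace_sum]
    simp only [← hG, trace_mul_outer, smul_eq_mul]
    have hs := Real.sq_sqrt hn'.le
    have hs0 : √(n : ℝ) ≠ 0 := (Real.sqrt_pos.2 hn').ne'
    field_simp
    rw [hs]
  have hlim : charFun (Measure.map id (gaussianReal 0 Var[fun ω => quadForm G (Z 0 ω); P].toNNReal)) 1
      = charFun (Measure.map id (multivariateGaussian 0 (CR Sig B))) t := by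
    rw [Measure.map_id, Measure.map_id, charFun_gaussianReal,
      charFun_multivariateGaussian (posSemidef_CR hSig hB), hvar,
      Real.coe_toNNReal _ (hvar ▸ variance_nonneg _ _)]
    simp
  change Tendsto _ _ (𝓝 (charFun (Measure.map id (multivariateGaussian 0 (CR Sig B))) t))
  rw [← hlim]
  refine hchar.congr fun n => ?_
  change _ = charFun (Measure.map (fun ω => √(n : ℝ) •
    (vecE (blockPart B ((n : ℝ)⁻¹ • ∑ l ∈ Finset.range n, outer (Z l ω))) - vecE Sig)) P) t
  rw [charFun_map_eq_charFun_inner (hmeas n) t]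
  simp only [hinner]
  rfl

theorem integral_norm_empMean_sq (hSig : Sig.PosDef)
    (hZ : ∀ l, HasLaw (Z l) (multivariateGaussian 0 Sig) P) (hindep : iIndepFun Z P) {n : ℕ}
    (hn : n ≠ 0) :
    Integrable (fun ω => ‖empMean n fun l => Z l ω‖ ^ 2) P ∧
      ∫ ω, ‖empMean n fun l => Z l ω‖ ^ 2 ∂P = (n : ℝ)⁻¹ * Sig.trace := by
  have hn' : (n : ℝ) ≠ 0 := Nat.cast_ne_zero.2 hn
  have hL2 : ∀ l i, MemLp (fun ω => Z l ω i) 2 P := by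
    intro l i
    have h : MemLp (fun x : EuclideanSpace ℝ (Fin p) => x i) 2 (multivariateGaussian 0 Sig) :=
      (EuclideanSpace.proj (𝕜 := ℝ) i).comp_memLp' (IsGaussian.memLp_two_id)
    rw [← (hZ l).map_eq] at h
    exact (memLp_map_measure_iff (by fun_prop) (hZ l).aemeasurable).1 h
  have hvar : ∀ l i, Var[fun ω => Z l ω i; P] = Sig i i := by
    intro l i
    rw [← variance_eval_multivariateGaussian (μ := 0) hSig.posSemidef i, ← (hZ l).map_eq,
      variance_map (by fun_prop) (hZ l).aemeasurable]
    rfl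
  have hmean : ∀ l i, ∫ ω, Z l ω i ∂P = 0 := by
    intro l i
    have h1 := (hZ l).integral_comp (f := fun x : EuclideanSpace ℝ (Fin p) => x i) (by fun_prop)
    have h2 := (EuclideanSpace.proj (𝕜 := ℝ) i).integral_comp_comm
      (IsGaussian.integrable_id (μ := multivariateGaussian (0 : EuclideanSpace ℝ (Fin p)) Sig))
    simp only [id_eq, integral_id_multivariateGaussian] at h2
    exact h1.trans h2
  have hmL2 : ∀ i, MemLp (fun ω => (empMean n fun l => Z l ω) i) 2 P := by
    intro i
    have : MemLp (fun ω => (n : ℝ)⁻¹ * ∑ l ∈ Finset.range n, Z l ω i) 2 P :=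
      (memLp_finsetSum _ fun l _ => hL2 l i).const_mul _
    simpa [empMean] using this
  have hcoord : ∀ i, ∫ ω, (empMean n fun l => Z l ω) i ^ 2 ∂P = (n : ℝ)⁻¹ * Sig i i := by
    intro i
    have h1 : Var[fun ω => (empMean n fun l => Z l ω) i; P] = (n : ℝ)⁻¹ * Sig i i := by
      have e : (fun ω => (empMean n fun l => Z l ω) i)
          = fun ω => (n : ℝ)⁻¹ * (∑ l ∈ Finset.range n, fun ω => Z l ω i) ω := by
        ext ω; simp [empMean]
      rw [e, variance_const_mul, IndepFun.variance_sum (fun l _ => hL2 l i)]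
      · simp only [hvar, Finset.sum_const, Finset.card_range, nsmul_eq_mul]
        field_simp
      · intro l _ l' _ hll
        exact (hindep.indepFun hll).comp (φ := fun x : EuclideanSpace ℝ (Fin p) => x i)
          (ψ := fun x : EuclideanSpace ℝ (Fin p) => x i) (by fun_prop) (by fun_prop)
    have h2 : ∫ ω, (empMean n fun l => Z l ω) i ∂P = 0 := by
      have e : (fun ω => (empMean n fun l => Z l ω) i)
          = fun ω => (n : ℝ)⁻¹ * ∑ l ∈ Finset.range n, Z l ω i := by
        ext ω; simp [empMean]
      rw [e, integral_const_mul, integral_finsetSum _ fun l _ => (hL2 l i).integrable (by norm_num)]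
      simp [hmean]
    rw [variance_eq_sub (hmL2 i), h2] at h1
    simpa using h1
  have hint : ∀ i, Integrable (fun ω => (empMean n fun l => Z l ω) i ^ 2) P :=
    fun i => (hmL2 i).integrable_sq
  simp only [EuclideanSpace.real_norm_sq_eq]
  refine ⟨integrable_finsetSum _ fun i _ => hint i, ?_⟩
  rw [integral_finsetSum _ fun i _ => hint i]
  simp only [hcoord, ← Finset.mul_sum]
  rfl

/-- The norm is at most `√n` times the squared norm of the mean, whose expectation is `tr Sig / n`;
Markov's inequality gives a bound of order `n^(-1/2)`. -/
theorem tendstoInMeasure_outer_empMean (hSig : Sig.PosDef)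
    (hZ : ∀ l, HasLaw (Z l) (multivariateGaussian 0 Sig) P) (hindep : iIndepFun Z P) :
    TendstoInMeasure P (fun (n : ℕ) ω => √(n : ℝ) •
      vecE (blockPart B (outer (empMean n fun l => Z l ω)))) atTop 0 := by
  rw [tendstoInMeasure_iff_measureReal_norm]
  intro ε hε
  simp only [Pi.zero_apply, sub_zero]
  have hlim : Tendsto (fun n : ℕ => ε⁻¹ * Sig.trace * (√(n : ℝ))⁻¹) atTop (𝓝 0) := by
    simpa using ((tendsto_inv_atTop_zero.comp
      (Real.tendsto_sqrt_atTop.comp tendsto_natCast_atTop_atTop)).const_mul (ε⁻¹ * Sig.trace))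
  refine tendsto_of_tendsto_of_tendsto_of_le_of_le' tendsto_const_nhds hlim
    (Eventually.of_forall fun n => measureReal_nonneg) ?_
  filter_upwards [eventually_ne_atTop 0] with n hn
  have hn' : (0 : ℝ) < n := by positivity
  have hs : 0 < √(n : ℝ) := Real.sqrt_pos.2 hn'
  obtain ⟨hint, hval⟩ := integral_norm_empMean_sq hSig hZ hindep hn
  have hsub : {ω | ε ≤ ‖√(n : ℝ) • vecE (blockPart B (outer (empMean n fun l => Z l ω)))‖}
      ⊆ {ω | ε / √(n : ℝ) ≤ ‖empMean n fun l => Z l ω‖ ^ 2} := by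
    intro ω hω
    have hω' : ε ≤ ‖√(n : ℝ) • vecE (blockPart B (outer (empMean n fun l => Z l ω)))‖ := hω
    rw [norm_smul, Real.norm_of_nonneg hs.le] at hω'
    have := hω'.trans (mul_le_mul_of_nonneg_left (norm_vecE_blockPart_outer_le B _) hs.le)
    change ε / √(n : ℝ) ≤ _
    rwa [div_le_iff₀' hs]
  refine (measureReal_mono hsub).trans ?_
  have hM := mul_meas_ge_le_integral_of_nonneg (ae_of_all P fun ω => by positivity) hint
    (ε / √(n : ℝ))
  rw [hval] at hM
  have e : ε⁻¹ * Sig.trace * (√(n : ℝ))⁻¹ = ((n : ℝ)⁻¹ * Sig.trace) / (ε / √(n : ℝ)) := by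
    have := Real.sq_sqrt hn'.le
    field_simp
    rw [this]
  rw [e, le_div_iff₀' (by positivity)]
  exact hM

/-- The central limit theorem for the block part of the empirical covariance matrix. -/
theorem tendstoInDistribution_blockPart_empCov (hSig : Sig.PosDef) (hB : blockPart B Sig = Sig)
    {X : ℕ → Ω → EuclideanSpace ℝ (Fin p)} {m : EuclideanSpace ℝ (Fin p)}
    (hX : ∀ l, HasLaw (X l) (multivariateGaussian m Sig) P) (hindep : iIndepFun X P) :
    TendstoInDistribution (fun (n : ℕ) ω => √(n : ℝ) •
        (vecE (blockPart B (empCov n fun l => X l ω)) - vecE Sig))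
      atTop id (fun _ => P) (multivariateGaussian 0 (CR Sig B)) := by
  have hsub : HasLaw (fun x : EuclideanSpace ℝ (Fin p) => x - m) (multivariateGaussian 0 Sig)
      (multivariateGaussian m Sig) := by
    refine ⟨by fun_prop, ?_⟩
    rw [multivariateGaussian, multivariateGaussian, Measure.map_map (by fun_prop) (by fun_prop)]
    congr 1
    ext x
    simp
  have hZ : ∀ l, HasLaw (fun ω => X l ω - m) (multivariateGaussian 0 Sig) P :=
    fun l => hsub.fun_comp (hX l)
  have hZi : iIndepFun (fun l ω => X l ω - m) P :=
    hindep.comp (fun _ x => x - m) fun _ => by fun_prop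
  -- Slutsky: after centring at `m`, the empirical covariance differs from the average of the
  -- `outer` terms only by the rank one matrix of the empirical mean.
  refine tendstoInDistribution_of_tendstoInMeasure_sub _ _
    (tendstoInDistribution_sum_outer hSig hB hZ hZi) ?_ fun n => ?_
  · have h := tendstoInMeasure_outer_empMean (B := B) hSig hZ hZi
    rw [tendstoInMeasure_iff_norm] at h ⊢
    intro ε hε
    refine (h ε hε).congr' ?_
    filter_upwards [eventually_ne_atTop 0] with n hn
    congr 1
    ext ω
    simp only [Pi.sub_apply, Pi.zero_apply, sub_zero, ← smul_sub]
    change ε ≤ _ ↔ ε ≤ _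
    rw [← empCov_sub_const hn (fun l => X l ω) m, empCov_eq_sub hn, blockPart_sub, vecE_sub,
      sub_sub_sub_cancel_right, sub_sub_cancel_left, smul_neg, norm_neg]
  · have h := aemeasurable_vecE_blockPart B (aemeasurable_empCov (fun l => (hX l).aemeasurable) n)
    exact (h.sub_const (vecE Sig)).const_smul (√(n : ℝ))

end CLT

end BlockCov

namespace BlockCov

/-! ### Events of vanishing probability -/

section Portmanteau

open Topology

variable {Ω : Type*} [MeasurableSpace Ω] {P : Measure Ω}

theorem tendsto_measure_zero_of_subset_union {A A₁ A₂ : ℕ → Set Ω}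
    (h₁ : Tendsto (fun n => P (A₁ n)) atTop (𝓝 0)) (h₂ : Tendsto (fun n => P (A₂ n)) atTop (𝓝 0))
    (h : ∀ᶠ n in atTop, A n ⊆ A₁ n ∪ A₂ n) : Tendsto (fun n => P (A n)) atTop (𝓝 0) := by
  refine tendsto_of_tendsto_of_tendsto_of_le_of_le' tendsto_const_nhds
    (by simpa using h₁.add h₂) (Eventually.of_forall fun n => zero_le) ?_
  filter_upwards [h] with n hn
  exact (measure_mono hn).trans (measure_union_le _ _)

theorem tendsto_measure_zero_of_subset {A A₁ : ℕ → Set Ω}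
    (h₁ : Tendsto (fun n => P (A₁ n)) atTop (𝓝 0)) (h : ∀ᶠ n in atTop, A n ⊆ A₁ n) :
    Tendsto (fun n => P (A n)) atTop (𝓝 0) :=
  tendsto_measure_zero_of_subset_union h₁ h₁
    (h.mono fun _ hn => hn.trans Set.subset_union_left)

theorem tendsto_measure_zero_iUnion {ι : Type*} [Finite ι] {A : ι → ℕ → Set Ω}
    (h : ∀ i, Tendsto (fun n => P (A i n)) atTop (𝓝 0)) :
    Tendsto (fun n => P (⋃ i, A i n)) atTop (𝓝 0) := by
  have := Fintype.ofFinite ι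
  refine tendsto_of_tendsto_of_tendsto_of_le_of_le tendsto_const_nhds
    (by simpa using tendsto_finsetSum Finset.univ fun i _ => h i) (fun n => zero_le) fun n => ?_
  exact measure_iUnion_fintype_le P fun i => A i n

/-- If `W n` converges in distribution to `ν`, and up to negligible events `A n` forces `W n` into
each of the closed sets `F k`, which decrease to a `ν`-null set, then `A n` is negligible. -/
theorem tendsto_measure_zero_of_closed [IsProbabilityMeasure P] {E : Type*} [MetricSpace E]
    [MeasurableSpace E] [BorelSpace E] {ν : Measure E} [IsProbabilityMeasure ν]
    {W : ℕ → Ω → E} (hW : TendstoInDistribution W atTop id (fun _ => P) ν) {A : ℕ → Set Ω}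
    {F : ℕ → Set E} (hF : ∀ k, IsClosed (F k)) (hanti : Antitone F) (hnull : ν (⋂ k, F k) = 0)
    (hA : ∀ k, Tendsto (fun n => P (A n \ {ω | W n ω ∈ F k})) atTop (𝓝 0)) :
    Tendsto (fun n => P (A n)) atTop (𝓝 0) := by
  rw [ENNReal.tendsto_nhds_zero]
  intro ε hε
  have hε2 : 0 < ε / 2 := ENNReal.half_pos hε.ne'
  have h1 := tendsto_measure_iInter_atTop (μ := ν) (fun k => (hF k).measurableSet.nullMeasurableSet)
    hanti ⟨0, measure_ne_top _ _⟩
  rw [hnull] at h1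
  obtain ⟨k, hk⟩ := (h1.eventually_lt_const hε2).exists
  have h2 := ProbabilityMeasure.limsup_measure_closed_le_of_tendsto hW.tendsto (hF k)
  simp only [ProbabilityMeasure.coe_mk, Measure.map_id] at h2
  have h3 := eventually_lt_of_limsup_lt (h2.trans_lt hk)
  filter_upwards [h3, (ENNReal.tendsto_nhds_zero.1 (hA k)) _ hε2] with n hn1 hn2
  have h4 : P {ω | W n ω ∈ F k} < ε / 2 := by
    have := Measure.map_apply_of_aemeasurable (hW.forall_aemeasurable n) (hF k).measurableSet
    exact this ▸ hn1
  calc P (A n) ≤ P (A n \ {ω | W n ω ∈ F k} ∪ {ω | W n ω ∈ F k}) :=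
        measure_mono (by rw [Set.sdiff_union_self]; exact Set.subset_union_left)
    _ ≤ ε / 2 + ε / 2 := (measure_union_le _ _).trans (add_le_add hn2 h4.le)
    _ = ε := ENNReal.add_halves ε

end Portmanteau

/-! ### Rate, consistency and absence of ties for the empirical covariance matrix. -/

section Sample

open Topology

variable {Ω : Type*} [MeasurableSpace Ω] {P : Measure Ω} [IsProbabilityMeasure P] {p : ℕ}
  {Sig : Matrix (Fin p) (Fin p) ℝ} {X : ℕ → Ω → EuclideanSpace ℝ (Fin p)}
  {m : EuclideanSpace ℝ (Fin p)}

theorem tendsto_rpow_neg_natCast {δ : ℝ} (hδ : 0 < δ) :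
    Tendsto (fun n : ℕ => (n : ℝ) ^ (-δ)) atTop (𝓝 0) :=
  (tendsto_rpow_neg_atTop hδ).comp tendsto_natCast_atTop_atTop

/-- The empirical covariance matrix converges at a speed faster than `n ^ (-δ)`. -/
theorem tendsto_measure_rpow_lt_norm (hSig : Sig.PosDef)
    (hX : ∀ l, HasLaw (X l) (multivariateGaussian m Sig) P) (hindep : iIndepFun X P) {δ : ℝ}
    (hδ : δ < 1 / 2) {C : ℝ} (hC : 0 < C) :
    Tendsto (fun n : ℕ => P {ω | (n : ℝ) ^ (-δ) <
      C * ‖vecE (empCov n fun l => X l ω) - vecE Sig‖}) atTop (𝓝 0) := by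
  have hW := tendstoInDistribution_blockPart_empCov hSig (blockPart_top (Γ := Sig)) hX hindep
  simp only [blockPart_top] at hW
  -- Tightness: on the event, `√n ‖S - Sig‖` exceeds `C⁻¹ n^(1/2 - δ)`, which eventually passes
  -- every `k`, while the sets `F k` have empty intersection.
  refine tendsto_measure_zero_of_closed hW (F := fun k : ℕ => {x | (k : ℝ) ≤ ‖x‖})
    (fun k => isClosed_le continuous_const continuous_norm) ?_ ?_ fun k => ?_
  · intro k l hkl x hx
    have hx' : (l : ℝ) ≤ ‖x‖ := hx
    exact (Nat.cast_le.2 hkl).trans hx'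
  · have : ⋂ k : ℕ, {x : EuclideanSpace ℝ (Fin p × Fin p) | (k : ℝ) ≤ ‖x‖} = ∅ := by
      refine Set.eq_empty_of_forall_notMem fun x hx => ?_
      obtain ⟨k, hk⟩ := exists_nat_gt ‖x‖
      exact absurd (Set.mem_iInter.1 hx k) (not_le.2 hk)
    rw [this, measure_empty]
  · have hlim : Tendsto (fun n : ℕ => C⁻¹ * (n : ℝ) ^ (1 / 2 - δ)) atTop atTop :=
      ((tendsto_rpow_atTop (by linarith)).comp tendsto_natCast_atTop_atTop).const_mul_atTop
        (inv_pos.2 hC)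
    refine tendsto_const_nhds.congr' ?_
    filter_upwards [hlim.eventually_ge_atTop (k : ℝ), eventually_gt_atTop 0] with n hn hn0
    have hn' : (0 : ℝ) < n := Nat.cast_pos.2 hn0
    symm
    rw [Set.sdiff_eq_empty.2, measure_empty]
    intro ω hω
    have hω' : (n : ℝ) ^ (-δ) < C * ‖vecE (empCov n fun l => X l ω) - vecE Sig‖ := hω
    change (k : ℝ) ≤ ‖√(n : ℝ) • _‖
    rw [norm_smul, Real.norm_of_nonneg (Real.sqrt_nonneg _)]
    refine hn.trans ?_
    rw [sub_eq_add_neg, Real.rpow_add hn', ← Real.sqrt_eq_rpow, inv_mul_le_iff₀ hC]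
    have := mul_le_mul_of_nonneg_left hω'.le (Real.sqrt_nonneg (n : ℝ))
    linarith

theorem tendsto_measure_not_of_eventually (hSig : Sig.PosDef)
    (hX : ∀ l, HasLaw (X l) (multivariateGaussian m Sig) P) (hindep : iIndepFun X P)
    {Q : EuclideanSpace ℝ (Fin p × Fin p) → Prop} (hQ : ∀ᶠ v in 𝓝 (vecE Sig), Q v) :
    Tendsto (fun n : ℕ => P {ω | ¬ Q (vecE (empCov n fun l => X l ω))}) atTop (𝓝 0) := by
  obtain ⟨r, hr, hball⟩ := Metric.eventually_nhds_iff.1 hQ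
  -- Any exponent in `(0, 1/2)` would do: eventually `n^(-1/4) < 1`, and the constant `1 / r` turns
  -- a distance of at least `r` into the tail event.
  refine tendsto_measure_zero_of_subset (tendsto_measure_rpow_lt_norm hSig hX hindep
    (δ := 1 / 4) (by norm_num) (inv_pos.2 hr)) ?_
  filter_upwards [(tendsto_rpow_neg_natCast (δ := 1 / 4) (by norm_num)).eventually_lt_const
    one_pos] with n hn ω hω
  change (n : ℝ) ^ (-(1 / 4) : ℝ) < r⁻¹ * _
  refine hn.trans_le ?_
  rw [le_inv_mul_iff₀ hr, mul_one]
  by_contra! h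
  exact hω (hball (by rwa [dist_eq_norm]))

/-- The covariance bound is degenerate on `ℝ^(p²)`, as it only sees symmetric directions. A
functional that is nonzero on some symmetric matrix has positive variance, and its Gaussian law then
has no atom. -/
theorem gaussian_ker_eq_zero (hSig : Sig.PosDef)
    (L : StrongDual ℝ (EuclideanSpace ℝ (Fin p × Fin p))) {H : Matrix (Fin p) (Fin p) ℝ}
    (hH : H.IsSymm) (hL : L (vecE H) ≠ 0) :
    multivariateGaussian 0 (CR Sig ⊤) {x | L x = 0} = 0 := by
  set w := (InnerProductSpace.toDual ℝ _).symm L with hw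
  have hLw : ∀ x, L x = inner ℝ w x := fun x =>
    (InnerProductSpace.toDual_symm_apply (𝕜 := ℝ) (y := L) (x := x)).symm
  have hT : blockPart ⊤ Sig = Sig := blockPart_top
  have hvar : Var[L; multivariateGaussian 0 (CR Sig ⊤)] = w.ofLp ⬝ᵥ CR Sig ⊤ *ᵥ w.ofLp := by
    rw [← covarianceBilin_multivariateGaussian (μ := 0) (posSemidef_CR hSig hT),
      covarianceBilin_self IsGaussian.memLp_two_id]
    exact congrArg (fun f => Var[f; multivariateGaussian 0 (CR Sig ⊤)]) (funext hLw)
  set G := symmBlock ⊤ (unvec w.ofLp) with hG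
  have hG0 : G ≠ 0 := by
    intro h0
    apply hL
    rw [hLw, real_inner_comm]
    have h := inner_vecE_blockPart (B := ⊤) hH w
    rw [blockPart_top, ← hG, h0, zero_mul, Matrix.trace_zero] at h
    exact h
  have hpos : 0 < Var[L; multivariateGaussian 0 (CR Sig ⊤)] := by
    have h1 : w.ofLp ⬝ᵥ CR Sig ⊤ *ᵥ w.ofLp = 2 * (G * Sig * G * Sig).trace :=
      CR_mulVec hSig hT (unvec w.ofLp)
    rw [hvar, h1]
    exact mul_pos two_pos (trace_sandwich_pos hSig G (isSymm_symmBlock _) hG0)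
  have hmap := IsGaussian.map_eq_gaussianReal (μ := multivariateGaussian 0 (CR Sig ⊤)) L
  have hn := nullSingletonClass_gaussianReal (μ := (multivariateGaussian 0 (CR Sig ⊤))[L])
    (Real.toNNReal_pos.2 hpos).ne'
  have h0 := hn.measure_singleton 0
  rw [← hmap, Measure.map_apply (by fun_prop) (measurableSet_singleton 0)] at h0
  exact h0

/-- The polynomial that vanishes when two correlations have the same absolute value. -/
def tiePoly (i j k l : Fin p) (v : EuclideanSpace ℝ (Fin p × Fin p)) : ℝ :=
  unvec v.ofLp i j ^ 2 * (unvec v.ofLp k k * unvec v.ofLp l l)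
    - unvec v.ofLp k l ^ 2 * (unvec v.ofLp i i * unvec v.ofLp j j)

theorem tiePoly_eq_zero {S : Matrix (Fin p) (Fin p) ℝ} (hS : ∀ i, 0 < S i i) {i j k l : Fin p}
    (h : |correlation S i j| = |correlation S k l|) : tiePoly i j k l (vecE S) = 0 := by
  have h2 : correlation S i j ^ 2 = correlation S k l ^ 2 := (sq_eq_sq_iff_abs_eq_abs _ _).2 h
  have hpos : ∀ i j, 0 < S i i * S j j := fun i j => mul_pos (hS i) (hS j)
  simp only [correlation, Matrix.of_apply, div_pow, Real.sq_sqrt (hpos _ _).le] at h2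
  rw [div_eq_div_iff (hpos i j).ne' (hpos k l).ne'] at h2
  simp only [tiePoly, unvec_vecE]
  linarith

theorem differentiable_tiePoly (i j k l : Fin p) : Differentiable ℝ (tiePoly i j k l) := by
  unfold tiePoly unvec
  simp only [Matrix.of_apply]
  fun_prop

/-- Among the entries in the polynomial this direction moves only the `(i, j)` one, so the
derivative is `2 σ_ij σ_kk σ_ll`. -/
theorem fderiv_tiePoly_ne_zero (hSig : Sig.PosDef) {i j k l : Fin p} (hij : i < j) (hkl : k < l)
    (hne : (i, j) ≠ (k, l)) (h0 : Sig i j ≠ 0) :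
    fderiv ℝ (tiePoly i j k l) (vecE Sig)
      (vecE (Matrix.single i j 1 + Matrix.single j i 1)) ≠ 0 := by
  set H : Matrix (Fin p) (Fin p) ℝ := Matrix.single i j 1 + Matrix.single j i 1 with hH
  have hline := ((differentiable_tiePoly i j k l) (vecE Sig)).hasFDerivAt.hasLineDerivAt (vecE H)
  have hHd : ∀ a, H a a = 0 := by
    intro a
    simp only [hH, Matrix.add_apply, Matrix.single_apply]
    rw [if_neg, if_neg, add_zero]
    · rintro ⟨rfl, rfl⟩; exact hij.ne rfl
    · rintro ⟨rfl, rfl⟩; exact hij.ne rfl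
  have hHij : H i j = 1 := by
    simp [hH, hij.ne']
  have hHkl : H k l = 0 := by
    simp only [hH, Matrix.add_apply, Matrix.single_apply]
    rw [if_neg, if_neg, add_zero]
    · rintro ⟨rfl, rfl⟩; exact hij.not_gt hkl
    · rintro ⟨rfl, rfl⟩; exact hne rfl
  have hval : ∀ t : ℝ, tiePoly i j k l (vecE Sig + t • vecE H) =
      (Sig i j + t) ^ 2 * (Sig k k * Sig l l) - Sig k l ^ 2 * (Sig i i * Sig j j) := by
    intro t
    rw [← vecE_smul, ← vecE_add]
    simp only [tiePoly, unvec_vecE, Matrix.add_apply, Matrix.smul_apply, hHd, hHij, hHkl,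
      smul_eq_mul, mul_zero, mul_one, add_zero]
  have hd : HasDerivAt (fun t : ℝ => tiePoly i j k l (vecE Sig + t • vecE H))
      (2 * Sig i j * (Sig k k * Sig l l)) 0 := by
    simp only [hval]
    have := (((((hasDerivAt_id' (0 : ℝ)).const_add (Sig i j)).fun_pow 2).mul_const
      (Sig k k * Sig l l)).sub_const (Sig k l ^ 2 * (Sig i i * Sig j j)))
    simpa using this
  rw [HasDerivAt.unique hline hd]
  exact mul_ne_zero (mul_ne_zero two_ne_zero h0) (mul_pos hSig.diag_pos hSig.diag_pos).ne'

/-- If the tie polynomial is nonzero at `Sig`, consistency excludes ties. If it vanishes there, a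
tie forces `L (S - Sig) = o(‖S - Sig‖)`, which puts `√n (S - Sig)` in arbitrarily narrow closed
cones around `ker L`; they shrink to `ker L`, which the limit law does not charge. -/
theorem tendsto_measure_tie (hSig : Sig.PosDef)
    (hX : ∀ l, HasLaw (X l) (multivariateGaussian m Sig) P) (hindep : iIndepFun X P)
    {i j k l : Fin p} (hij : i < j) (hkl : k < l) (hne : (i, j) ≠ (k, l)) (h0 : Sig i j ≠ 0) :
    Tendsto (fun n : ℕ => P {ω | |correlation (empCov n fun l => X l ω) i j| =
      |correlation (empCov n fun l => X l ω) k l|}) atTop (𝓝 0) := by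
  set L := fderiv ℝ (tiePoly i j k l) (vecE Sig) with hL
  have hdiag : ∀ᶠ v in 𝓝 (vecE Sig), ∀ a : Fin p, 0 < unvec v.ofLp a a :=
    eventually_all.2 fun a =>
      (continuous_unvec_apply a a).continuousAt.eventually_const_lt hSig.diag_pos
  by_cases hg : tiePoly i j k l (vecE Sig) = 0
  · have hW := tendstoInDistribution_blockPart_empCov hSig (blockPart_top (Γ := Sig)) hX hindep
    simp only [blockPart_top] at hW
    refine tendsto_measure_zero_of_closed hW
      (F := fun q : ℕ => {x | ‖L x‖ ≤ ((q : ℝ) + 1)⁻¹ * ‖x‖})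
      (fun q => isClosed_le (by fun_prop) (by fun_prop)) ?_ ?_ fun q => ?_
    · intro a b hab x hx
      have hx' : ‖L x‖ ≤ ((b : ℝ) + 1)⁻¹ * ‖x‖ := hx
      refine hx'.trans (mul_le_mul_of_nonneg_right ?_ (norm_nonneg _))
      exact inv_anti₀ (by positivity) (by gcongr)
    · refine measure_mono_null (t := {x | L x = 0}) (fun x hx => ?_)
        (gaussian_ker_eq_zero hSig L (H := Matrix.single i j 1 + Matrix.single j i 1) ?_
          (fderiv_tiePoly_ne_zero hSig hij hkl hne h0))
      · have hlim : Tendsto (fun q : ℕ => ((q : ℝ) + 1)⁻¹ * ‖x‖) atTop (𝓝 0) := by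
          have := (tendsto_one_div_add_atTop_nhds_zero_nat (𝕜 := ℝ)).mul_const ‖x‖
          simpa using this
        have := ge_of_tendsto' hlim fun q => Set.mem_iInter.1 hx q
        exact norm_le_zero_iff.1 this
      · rw [Matrix.IsSymm, Matrix.transpose_add, Matrix.transpose_single, Matrix.transpose_single,
          add_comm]
    · have hlo := ((differentiable_tiePoly i j k l) (vecE Sig)).hasFDerivAt.isLittleO.def
        (c := ((q : ℝ) + 1)⁻¹) (by positivity)
      refine tendsto_measure_zero_of_subset
        (tendsto_measure_not_of_eventually hSig hX hindep (hlo.and hdiag))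
        (Eventually.of_forall fun n ω hω => ?_)
      rintro ⟨h1, h2⟩
      refine hω.2 ?_
      have htie := tiePoly_eq_zero h2 hω.1
      rw [unvec_vecE] at htie
      rw [htie, hg, sub_zero, zero_sub, norm_neg] at h1
      change ‖L (√(n : ℝ) • _)‖ ≤ _ * ‖√(n : ℝ) • _‖
      rw [map_smul, norm_smul, norm_smul, mul_left_comm]
      exact mul_le_mul_of_nonneg_left h1 (norm_nonneg _)
  · have hev := (differentiable_tiePoly i j k l).continuous.continuousAt.eventually_ne hg
    refine tendsto_measure_zero_of_subset
      (tendsto_measure_not_of_eventually hSig hX hindep (hev.and hdiag))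
      (Eventually.of_forall fun n ω hω => ?_)
    rintro ⟨h1, h2⟩
    exact h1 (tiePoly_eq_zero h2 hω)

end Sample

end BlockCov

namespace BlockCov

/-! ### Selection of the structure and conclusion -/

section Conclusion

open Topology

variable {Ω : Type*} [MeasurableSpace Ω] {P : Measure Ω} [IsProbabilityMeasure P] {p : ℕ}
  {Sig : Matrix (Fin p) (Fin p) ℝ} {Bstar : Setoid (Fin p)}
  {X : ℕ → Ω → EuclideanSpace ℝ (Fin p)} {m : EuclideanSpace ℝ (Fin p)} {δ : ℝ}

theorem mul_kappa (hp : 0 < p) (n : ℕ) (δ : ℝ) : p * kappa p n δ = (n : ℝ) ^ (-δ) := by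
  have : (p : ℝ) ≠ 0 := by positivity
  rw [kappa, Real.rpow_neg (Nat.cast_nonneg n)]
  field_simp

/-- If the candidate set contains the true structure with probability tending to one, then a
minimiser of the criterion over it yields the same block part as the true structure, with
probability tending to one. -/
theorem tendsto_measure_blockPart_ne (hp : 0 < p) (hSig : Sig ∈ posDefWithStructure Bstar)
    (hX : ∀ l, HasLaw (X l) (multivariateGaussian m Sig) P) (hindep : iIndepFun X P)
    (hδ0 : 0 < δ) (hδ1 : δ < 1 / 2) {Bhat : ℕ → Ω → Setoid (Fin p)}
    {𝓑 : Matrix (Fin p) (Fin p) ℝ → Set (Setoid (Fin p))}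
    (hcand : Tendsto (fun n : ℕ => P {ω | Bstar ∉ 𝓑 (empCov n fun l => X l ω)}) atTop (𝓝 0))
    (hBhat : ∀ n ω, (empCov n fun l => X l ω).PosDef →
      IsArgmin (partCrit (kappa p n δ) (empCov n fun l => X l ω))
        (𝓑 (empCov n fun l => X l ω)) (Bhat n ω)) :
    Tendsto (fun n : ℕ => P {ω | blockPart (Bhat n ω) (empCov n fun l => X l ω) ≠
      blockPart Bstar (empCov n fun l => X l ω)}) atTop (𝓝 0) := by
  obtain ⟨K, hK, hlip⟩ := exists_eventually_abs_log_det_sub_le hSig.1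
  have hnear := tendsto_measure_not_of_eventually hSig.1 hX hindep
    (hlip.and ((eventually_det_ne_zero hSig.1).and (eventually_pattern (Sig := Sig))))
  -- With `4 * K`, the complementary event bounds every log-determinant error by a quarter of
  -- `n^(-δ)`.
  have htail := tendsto_measure_rpow_lt_norm hSig.1 hX hindep hδ1 (C := 4 * K) (by positivity)
  have hgap : ∀ᶠ n : ℕ in atTop, ∀ B : Setoid (Fin p), blockPart B Sig ≠ Sig →
      Real.log Sig.det + (n : ℝ) ^ (-δ) * ((p : ℝ) ^ 2 + 1) < Real.log (blockPart B Sig).det := by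
    refine eventually_all.2 fun B => eventually_imp_distrib_left.2 fun hB => ?_
    have hlim := ((tendsto_rpow_neg_natCast hδ0).mul_const ((p : ℝ) ^ 2 + 1)).const_add
      (Real.log Sig.det)
    rw [zero_mul, add_zero] at hlim
    exact hlim.eventually_lt_const
      (Real.log_lt_log hSig.1.det_pos (det_lt_det_blockPart hSig.1 hB))
  refine tendsto_measure_zero_of_subset_union hcand
    (tendsto_measure_zero_of_subset_union hnear htail
      (A := fun n => {ω | ¬ _} ∪ {ω | _ < _}) (Eventually.of_forall fun n => subset_rfl)) ?_
  filter_upwards [hgap, eventually_gt_atTop 0] with n hn hn0 ω hω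
  by_contra hgood
  simp only [Set.mem_union, not_or] at hgood
  obtain ⟨h1, h2, h3⟩ := hgood
  obtain ⟨h4, h5, h6⟩ := not_not.1 h2
  have h7 : 4 * K * ‖vecE (empCov n fun l => X l ω) - vecE Sig‖ ≤ (n : ℝ) ^ (-δ) := not_lt.1 h3
  have hPD : (empCov n fun l => X l ω).PosDef :=
    (posSemidef_empCov n _).posDef_iff_det_ne_zero.2 h5
  refine hω (blockPart_eq_of_isArgmin hp hSig hPD (Real.rpow_pos_of_pos (Nat.cast_pos.2 hn0) _)
    (mul_kappa hp n δ) (fun B => (h4 B).trans ?_) h6 hn (not_not.1 h1) rfl (hBhat n ω hPD))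
  linarith

/-- The true structure is one of the thresholded structures, with probability tending to one. -/
theorem tendsto_measure_notMem_thresholdPartition (hSig : Sig ∈ posDefWithStructure Bstar)
    (hX : ∀ l, HasLaw (X l) (multivariateGaussian m Sig) P) (hindep : iIndepFun X P)
    (hp : 3 ≤ p ∨ (p = 2 ∧ Bstar = ⊥)) :
    Tendsto (fun n : ℕ => P {ω | Bstar ∉ thresholdPartition (empCov n fun l => X l ω) ''
      thresholdGrid (empCov n fun l => X l ω)}) atTop (𝓝 0) := by
  have hsymm : ∀ (n : ℕ) ω, (empCov n fun l => X l ω).IsSymm := by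
    intro n ω
    have := (posSemidef_empCov n fun l => X l ω).isHermitian
    rwa [Matrix.IsHermitian, Matrix.conjTranspose_eq_transpose_of_trivial] at this
  by_cases h0 : ∃ k l, k < l ∧ Sig k l = 0
  · obtain ⟨k, l, hkl, hz⟩ := h0
    refine tendsto_measure_zero_of_subset (tendsto_measure_not_of_eventually hSig.1 hX hindep
      (eventually_correlation_lt hSig.1)) (Eventually.of_forall fun n ω hω hcorr => hω ?_)
    exact mem_thresholdPartition_of_zero hSig (hsymm n ω) hkl hz hcorr
  · push Not at h0
    -- For `p = 2` a diagonal `Sig` has a zero off the diagonal, which the present case excludes.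
    have hp3 : 3 ≤ p := by
      rcases hp with h | ⟨rfl, rfl⟩
      · exact h
      · exact absurd (blockPart_eq_self_iff.1 hSig.2.1.symm 0 1 (h0 0 1 (by decide)))
          (by change ¬ ((0 : Fin 2) = 1); decide)
    have htie : ∀ q : (Fin p × Fin p) × (Fin p × Fin p), Tendsto (fun n : ℕ => P {ω |
        q.1.1 < q.1.2 ∧ q.2.1 < q.2.2 ∧ q.1 ≠ q.2 ∧
          |correlation (empCov n fun l => X l ω) q.1.1 q.1.2| =
            |correlation (empCov n fun l => X l ω) q.2.1 q.2.2|}) atTop (𝓝 0) := by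
      intro q
      by_cases hq : q.1.1 < q.1.2 ∧ q.2.1 < q.2.2 ∧ q.1 ≠ q.2
      · exact tendsto_measure_zero_of_subset (tendsto_measure_tie hSig.1 hX hindep hq.1 hq.2.1
          hq.2.2 (h0 _ _ hq.1)) (Eventually.of_forall fun n ω hω => hω.2.2.2)
      · exact tendsto_measure_zero_of_subset (A₁ := fun _ => ∅) (by simp)
          (Eventually.of_forall fun n ω hω => hq ⟨hω.1, hω.2.1, hω.2.2.1⟩)
    refine tendsto_measure_zero_of_subset (tendsto_measure_zero_iUnion htie)
      (Eventually.of_forall fun n ω hω => ?_)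
    by_contra hno
    refine hω (mem_thresholdPartition_of_ne_zero hp3 hSig h0
      fun i j k l hij hkl hne heq => hno ?_)
    exact Set.mem_iUnion.2 ⟨((i, j), (k, l)), hij, hkl, hne, heq⟩

end Conclusion

/-- Glues the finitely many measurable pieces along the level sets of the selected partition. -/
theorem aemeasurable_of_discrete {Ω : Type*} [MeasurableSpace Ω] {P : Measure Ω} {α E : Type*} [Finite α] [AddCommMonoid E] [MeasurableSpace E]
    [MeasurableAdd₂ E] {f : Ω → α} (hf : ∀ a, NullMeasurableSet {ω | f ω = a} P) {g : α → Ω → E}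
    (hg : ∀ a, AEMeasurable (g a) P) : AEMeasurable (fun ω => g (f ω) ω) P := by
  classical
  have := Fintype.ofFinite α
  have h : (fun ω => g (f ω) ω) = fun ω => ∑ a, Set.indicator {ω | f ω = a} (g a) ω := by
    ext ω
    rw [Finset.sum_eq_single (f ω)]
    · exact (Set.indicator_of_mem (s := {ω' | f ω' = f ω}) rfl (g (f ω))).symm
    · intro a _ ha
      exact Set.indicator_of_notMem (s := {ω' | f ω' = a}) (fun h => ha (Eq.symm h)) (g a)
    · simp
  rw [h]
  exact Finset.aemeasurable_fun_sum _ fun a _ => (hg a).indicator₀ (hf a)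

end BlockCov

theorem mainTheorem10 {Ω : Type*} [MeasurableSpace Ω] (P : Measure Ω) [IsProbabilityMeasure P]
    (p : ℕ) (hp : 0 < p)
    (μ : EuclideanSpace ℝ (Fin p)) (Sig : Matrix (Fin p) (Fin p) ℝ) (Bstar : Setoid (Fin p))
    (hSig : Sig ∈ BlockCov.posDefWithStructure Bstar)
    (X : ℕ → Ω → EuclideanSpace ℝ (Fin p))
    (hlaw : ∀ l, HasLaw (X l) (multivariateGaussian μ Sig) P)
    (hindep : iIndepFun X P)
    (δ : ℝ) (hδ0 : 0 < δ) (hδ1 : δ < 1 / 2)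
    (Bhat : ℕ → Ω → Setoid (Fin p))
    (hmeas : ∀ n B, NullMeasurableSet {ω | Bhat n ω = B} P)
    -- `Bhat` is one of the two estimators, whenever the criterion makes sense,
    -- that is when the empirical covariance matrix is positive definite
    (hBhat :
      (∀ n ω, (BlockCov.empCov n fun l => X l ω).PosDef →
        BlockCov.IsBtot (BlockCov.kappa p n δ) (BlockCov.empCov n fun l => X l ω) (Bhat n ω)) ∨
      ((3 ≤ p ∨ (p = 2 ∧ Bstar = ⊥)) ∧
        ∀ n ω, (BlockCov.empCov n fun l => X l ω).PosDef →
          BlockCov.IsBcorr (BlockCov.kappa p n δ) (BlockCov.empCov n fun l => X l ω)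
            (Bhat n ω))) :
    (BlockCov.CR Sig Bstar).PosSemidef ∧
    TendstoInDistribution
      (fun (n : ℕ) (ω : Ω) => √(n : ℝ) •
        (BlockCov.vecE (BlockCov.blockPart (Bhat n ω) (BlockCov.empCov n fun l => X l ω))
          - BlockCov.vecE Sig))
      atTop id (fun _ => P) (multivariateGaussian 0 (BlockCov.CR Sig Bstar)) := by
  have hstruct : BlockCov.blockPart Bstar Sig = Sig := hSig.2.1.symm
  refine ⟨BlockCov.posSemidef_CR hSig.1 hstruct, ?_⟩
  have hne : Tendsto (fun n : ℕ =>
      P {ω | BlockCov.blockPart (Bhat n ω) (BlockCov.empCov n fun l => X l ω) ≠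
        BlockCov.blockPart Bstar (BlockCov.empCov n fun l => X l ω)}) atTop (nhds 0) := by
    rcases hBhat with h | ⟨hp3, h⟩
    · exact BlockCov.tendsto_measure_blockPart_ne hp hSig hlaw hindep hδ0 hδ1
        (𝓑 := fun _ => Set.univ) (by simp) h
    · exact BlockCov.tendsto_measure_blockPart_ne hp hSig hlaw hindep hδ0 hδ1
        (𝓑 := fun S => BlockCov.thresholdPartition S '' BlockCov.thresholdGrid S)
        (BlockCov.tendsto_measure_notMem_thresholdPartition hSig hlaw hindep hp3) h
  -- Off the event of `hne` the difference with the oracle sequence is exactly zero, so the factor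
  -- `√n` does no harm.
  refine tendstoInDistribution_of_tendstoInMeasure_sub _ _
    (BlockCov.tendstoInDistribution_blockPart_empCov hSig.1 hstruct hlaw hindep) ?_ fun n => ?_
  · rw [tendstoInMeasure_iff_norm]
    intro ε hε
    refine BlockCov.tendsto_measure_zero_of_subset hne (Eventually.of_forall fun n ω hω heq => ?_)
    have hω' : ε ≤ ‖(0 : EuclideanSpace ℝ (Fin p × Fin p))‖ := by
      convert! hω using 2
      simp [heq]
    rw [norm_zero] at hω'
    exact hω'.not_gt hε
  · exact BlockCov.aemeasurable_of_discrete
      (g := fun B ω => √(n : ℝ) •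
        (BlockCov.vecE (BlockCov.blockPart B (BlockCov.empCov n fun l => X l ω))
          - BlockCov.vecE Sig)) (hmeas n) fun B =>
      ((BlockCov.aemeasurable_vecE_blockPart B (BlockCov.aemeasurable_empCov
        (fun l => (hlaw l).aemeasurable) n)).sub_const (BlockCov.vecE Sig)).const_smul (√(n : ℝ))
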